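/- Let $\Gamma$ be a compact tropical curve, that is, the metric space obtained from a finite connected nonempty graph (loops and multiple edges allowed) by giving every edge a positive real length, and let $g=|E|-|V|+1$ be its genus (first Betti number). A divisor on $\Gamma$ is a finite formal sum $D=\sum_{v\in\Gamma}D(v)(v)$ with $D(v)\in\mathbb Z$, of degree $\deg D=\sum_v D(v)$; it is effective, written $D\ge 0$, if all $D(v)\ge 0$. A rational function on $\Gamma$ is a continuous function $f:\Gamma\to\mathbb R$ that on each edge has finitely many linear parts, with integer slopes; $\operatorname{div}(f)=\sum_v\operatorname{ord}_v(f)(v)$, where $\operatorname{ord}_v(f)$ is the sum of the outgoing slopes of $f$ at $v$. Write $D\sim D'$ if $D=D'+\operatorname{div}(f)$ for some rational function $f$, let $|D|$ be the set of all effective divisors linearly equivalent to $D$, and let the rank of $D$ be $$r(D)=\min\{\deg(D') : D'\ge 0,\ |D-D'|=\emptyset\}-1.$$ For a closed connected nonempty set $X\subseteq\Gamma$ and $v\in\partial X$, let $\deg^{\mathrm{out}}_X(v)$ be the number of edges (tangent directions) leaving $X$ at $v$. A divisor $D'$ is $P$-reduced if $D'(v)\ge 0$ for all $v\ne P$ and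 every closed connected nonempty $X\not\ni P$ has a point $v\in\partial X$ with $D'(v)<\deg^{\mathrm{out}}_X(v)$. For a divisor $D$ and $P\in\Gamma$ let $D_P$ be the unique $P$-reduced divisor linearly equivalent to $D$. Theorem. Let $D$ be a divisor on $\Gamma$ of positive rank. (1) Let $a\ge 1$ be an integer, and suppose that $g\ge 1$ or $a<\deg D$. If $D_P(P)\ge a$ for every $P\in\Gamma$, then there is a point $P\in\Gamma$ with $D_P(P)\ge a+1$. (2) If $g\ge 1$, then $\Gamma$ has a $D$-Weierstrass point, that is, a point $P$ with $D_P(P)\ge r(D)+1$. -/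

import Mathlib

open Set Filter Topology

noncomputable section

/-- A compact tropical curve given by a weighted-graph model: a connected nonempty multigraph
(loops and multiple edges allowed) with a positive real length on each edge. Finiteness of `V` and
`E` is required where the structure is used. -/
structure MetricGraph (V E : Type*) where
  /-- one end of an edge -/
  src : E → V
  /-- the other end of an edge -/
  tgt : E → V
  /-- length of an edge -/
  len : E → ℝ
  len_pos : ∀ e, 0 < len e
  nonempty : Nonempty V
  connected : ∀ u v : V, Relation.EqvGen (fun x y => ∃ e, src e = x ∧ tgt e = y) u v

namespace MetricGraph

variable {V E : Type*} (Γ : MetricGraph V E)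

/-- The points of the geometric representation: the vertices, and the points in the interior of an
edge, given by their distance from the end `src e` along the edge. -/
inductive Point (Γ : MetricGraph V E)
  | vertex (v : V) : Point Γ
  | inner (e : E) (t : ℝ) (h₀ : 0 < t) (h₁ : t < Γ.len e) : Point Γ

/-- The interval `[0, len e]` mapped onto the edge `e`; parameters outside are clamped. -/
def edgePt (e : E) (t : ℝ) : Γ.Point :=
  if h₀ : t ≤ 0 then Point.vertex (Γ.src e)
  else if h₁ : Γ.len e ≤ t then Point.vertex (Γ.tgt e)
  else Point.inner e t (not_le.1 h₀) (not_le.1 h₁)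

/-- The quotient topology: `U` is open iff its preimage in every edge interval is open. -/
instance : TopologicalSpace Γ.Point :=
  ⨆ e, TopologicalSpace.coinduced (Γ.edgePt e) inferInstance

/-- The genus (first Betti number) `|E| - |V| + 1`. -/
def genus (_Γ : MetricGraph V E) : ℤ := (Nat.card E : ℤ) - (Nat.card V : ℤ) + 1

/-- The unit tangent directions of the curve: at the point with parameter `t` of an edge `e`, the
direction of increasing parameter (if `t < len e`) and of decreasing parameter (if `0 < t`). -/
inductive Dir (Γ : MetricGraph V E)
  | fwd (e : E) (t : ℝ) (ht : t ∈ Ico 0 (Γ.len e)) : Dir Γ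
  | bwd (e : E) (t : ℝ) (ht : t ∈ Ioc 0 (Γ.len e)) : Dir Γ

/-- The point at distance `s` (small, nonnegative) along a tangent direction. -/
def ray : Γ.Dir → ℝ → Γ.Point
  | .fwd e t _, s => Γ.edgePt e (t + s)
  | .bwd e t _, s => Γ.edgePt e (t - s)

/-- The point at which a tangent direction is based. -/
def base (d : Γ.Dir) : Γ.Point := Γ.ray d 0

/-- Rational functions: continuous real functions that on every edge have finitely many linear
parts, all with integer slopes. -/
def IsRational (f : Γ.Point → ℝ) : Prop :=
  Continuous f ∧ ∀ e : E, ∃ (n : ℕ) (t : ℕ → ℝ) (m : ℕ → ℤ),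
    t 0 = 0 ∧ t n = Γ.len e ∧ (∀ i < n, t i < t (i + 1)) ∧
    ∀ i < n, ∀ s ∈ Icc (t i) (t (i + 1)),
      f (Γ.edgePt e s) = f (Γ.edgePt e (t i)) + m i * (s - t i)

/-- The outgoing slope of `f` along a tangent direction. -/
def slope (f : Γ.Point → ℝ) (d : Γ.Dir) : ℝ :=
  derivWithin (fun s => f (Γ.ray d s)) (Ici 0) 0

/-- The order of `f` at `P`: the sum of the outgoing slopes of `f` at `P`. This is the coefficient
of `P` in `div f`. -/
def ord (f : Γ.Point → ℝ) (P : Γ.Point) : ℝ :=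
  ∑ᶠ (d : Γ.Dir) (_ : Γ.base d = P), Γ.slope f d

/-- Divisors: the free abelian group on the points. -/
abbrev Divisor (Γ : MetricGraph V E) : Type _ := Γ.Point →₀ ℤ

/-- The degree of a divisor. -/
def deg (D : Γ.Divisor) : ℤ := D.sum fun _ n => n

/-- Linear equivalence: `D = D' + div f` for some rational function `f`. -/
def LinEquiv (D D' : Γ.Divisor) : Prop :=
  ∃ f : Γ.Point → ℝ, Γ.IsRational f ∧ ∀ P, (D P : ℝ) = D' P + Γ.ord f P

/-- The complete linear system `|D|`. -/
def linearSystem (D : Γ.Divisor) : Set Γ.Divisor :=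
  {D' | 0 ≤ D' ∧ Γ.LinEquiv D' D}

/-- The rank: the least degree of an effective divisor `D'` with `|D - D'| = ∅`, minus one. -/
def rank (D : Γ.Divisor) : ℤ :=
  (sInf {n : ℕ | ∃ D' : Γ.Divisor, 0 ≤ D' ∧ Γ.deg D' = n ∧ Γ.linearSystem (D - D') = ∅} : ℕ) - 1

/-- The number of edges leaving `X` at `v`: the number of tangent directions at `v` along which a
small segment meets `X` at most in `v`. -/
def outDeg (X : Set Γ.Point) (v : Γ.Point) : ℕ :=
  {d : Γ.Dir | Γ.base d = v ∧ ∃ ε > 0, ∀ s ∈ Ioc 0 ε, Γ.ray d s ∉ X}.ncard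

/-- `D` is `P`-reduced: its coefficients away from `P` are nonnegative, and every closed connected
(nonempty) set that does not contain `P` has a non-saturated boundary point. -/
def IsReduced (P : Γ.Point) (D : Γ.Divisor) : Prop :=
  (∀ v, v ≠ P → 0 ≤ D v) ∧
  ∀ X : Set Γ.Point, IsClosed X → IsConnected X → P ∉ X →
    ∃ v ∈ frontier X, D v < Γ.outDeg X v

open scoped Classical in
/-- `D_P`, the (unique) `P`-reduced divisor linearly equivalent to `D`. -/
def reducedDivisor (D : Γ.Divisor) (P : Γ.Point) : Γ.Divisor :=
  if h : ∃ D' : Γ.Divisor, Γ.IsReduced P D' ∧ Γ.LinEquiv D' D then h.choose else 0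

/-- `P` is a `D`-Weierstrass point: the coefficient of `D_P` at `P` is at least `r(D) + 1`. -/
def IsWeierstrassPoint (D : Γ.Divisor) (P : Γ.Point) : Prop :=
  Γ.rank D + 1 ≤ Γ.reducedDivisor D P P

end MetricGraph

end

/-!
Let `D` have a reduced divisor `D_P` with `D_P(P) = a ≥ 1` for every point `P`. The point is that all
of `D_P` is then concentrated at `P`, and that this is impossible on a curve with a cycle.

If `D_Q = D_P + div f`, then `f` is maximal at `P` and minimal at `Q`, because the components of the
maximum locus of a function that keeps a `P`-reduced divisor effective contain `P`
(`IsReduced.le_apply`). When `Q` is close to `P`, convexity of `f` where `D_P` has no chips, and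
integrality of its slopes, leave one possibility: near `P` the function falls with slope `a` along
`PQ` and is constant in all other directions (`IsReducedFamily.exists_slide`). Hence, away from the
segment `PQ`, the maximum of `f` propagates from `P`, and its minimum from `Q`, along every path up to
the next chip. Moving the base point backwards along a simple path from a point `v`, these two facts
show that no chip can lie on the path (`IsReducedFamily.eq_zero_on_arc`), so `D_P = a (P)` for all `P`.
Then `a = deg D`; and if the genus is positive, some edge can be removed without disconnecting the
curve. With `P` and `Q` on that edge, the maximum of `f` propagates from `P` around to `Q`, so `f` is
constant: a contradiction (`IsReducedFamily.false_of_connected_compl`). This is the first claim.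

For the second, `D_P(P) ≥ r(D)` for all `P`: there is an effective divisor equivalent to `D` with
coefficient at least `r(D)` at `P`, and by the maximum principle above `D_P` has the largest
coefficient at `P` among the effective divisors equivalent to `D`. This needs the existence of `D_P`
(`exists_isReduced`). It is `D' + div f₀`, where `D'` is any effective divisor equivalent to `D` and
`f₀` is the pointwise supremum of the rational functions `f` that vanish at `P` and keep `D' + div f`
effective. Principal divisors have degree zero, which bounds the slopes of these `f`
(`neg_deg_le_slope`); being convex off the chips of `D'`, with integer slopes in a bounded range, they
have a supremum of the same kind (`exists_greatest_section`). A closed set that violates reducedness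
could be fired, which would produce a larger function than `f₀`.

Throughout, rational functions are handled through their germs along tangent directions
(`isRational_iff`), and statements along edges are reduced to piecewise linear functions of one real
variable.
-/

/-! ### Induction along a real interval and piecewise linear functions of one variable -/

/-- Induction along `[a, b]`: a property that holds at `a`, extends a little to the right of every
point where it holds, and passes to left limits, holds on all of `[a, b]`. -/
theorem Icc_induction {p : ℝ → Prop} {a b : ℝ} (h0 : p a)
    (hr : ∀ x ∈ Ico a b, (∀ y ∈ Icc a x, p y) → ∃ y > x, ∀ z ∈ Ioo x y, p z)
    (hl : ∀ x ∈ Ioc a b, (∀ y ∈ Ico a x, p y) → p x) : ∀ x ∈ Icc a b, p x := by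
  by_contra! hcon
  obtain ⟨w, hw, hpw⟩ := hcon
  let S := {x | x ∈ Icc a b ∧ ¬ p x}
  have hS : BddBelow S := ⟨a, fun x hx => hx.1.1⟩
  have hne : S.Nonempty := ⟨w, hw, hpw⟩
  set x := sInf S with hx
  have hax : a ≤ x := le_csInf hne fun y hy => hy.1.1
  have hxb : x ≤ b := (csInf_le hS ⟨hw, hpw⟩).trans hw.2
  have hbelow : ∀ y ∈ Ico a x, p y := fun y hy => by
    by_contra h
    exact absurd (csInf_le hS (show y ∈ S from ⟨⟨hy.1, hy.2.le.trans hxb⟩, h⟩)) (not_le.2 hy.2)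
  have hpx : p x := by
    rcases hax.eq_or_lt with h | h
    · rwa [← h]
    · exact hl x ⟨h, hxb⟩ hbelow
  rcases hxb.eq_or_lt with h | h
  · have : w = x := le_antisymm (h ▸ hw.2) (csInf_le hS ⟨hw, hpw⟩)
    exact hpw (this ▸ hpx)
  obtain ⟨y, hy, hz⟩ := hr x ⟨hax, h⟩ fun y hy => by
    rcases hy.2.eq_or_lt with h | h
    · rwa [h]
    · exact hbelow y ⟨hy.1, h⟩
  obtain ⟨z, hzS, hzy⟩ := exists_lt_of_csInf_lt hne hy
  rcases (csInf_le hS hzS).eq_or_lt with h' | h'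
  · exact hzS.2 (h' ▸ hpx)
  · exact hzS.2 (hz z ⟨h', hzy⟩)

/-- `g` is affine with slope `m` on a right neighbourhood of `x`. -/
def RGerm (g : ℝ → ℝ) (x m : ℝ) : Prop := ∃ ε > 0, ∀ u ∈ Icc 0 ε, g (x + u) = g x + m * u

/-- `g` is affine with slope `m` on a left neighbourhood of `x`. -/
def LGerm (g : ℝ → ℝ) (x m : ℝ) : Prop := ∃ ε > 0, ∀ u ∈ Icc 0 ε, g (x - u) = g x - m * u

/-- The slope of `g` to the right of `x`. -/
noncomputable def rslope (g : ℝ → ℝ) (x : ℝ) : ℝ := derivWithin (fun u => g (x + u)) (Ici 0) 0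

/-- The slope of `g` to the left of `x`. -/
noncomputable def lslope (g : ℝ → ℝ) (x : ℝ) : ℝ := -derivWithin (fun u => g (x - u)) (Ici 0) 0

/-- `g` is piecewise linear on `[α, β]` with integer slopes, expressed through one-sided germs. -/
def IsPL (g : ℝ → ℝ) (α β : ℝ) : Prop :=
  (∀ x ∈ Ico α β, ∃ m : ℤ, RGerm g x m) ∧ ∀ x ∈ Ioc α β, ∃ m : ℤ, LGerm g x m

theorem derivWithin_of_affine {g : ℝ → ℝ} {m ε : ℝ} (hε : 0 < ε)
    (h : ∀ u ∈ Icc 0 ε, g u = g 0 + m * u) : derivWithin g (Ici 0) 0 = m := by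
  have h1 : HasDerivWithinAt (fun u => g 0 + m * u) m (Ici 0) 0 := by
    simpa using ((hasDerivAt_id (0 : ℝ)).const_mul m).const_add (g 0) |>.hasDerivWithinAt
  have h2 : g =ᶠ[𝓝[Ici 0] 0] fun u => g 0 + m * u := by
    filter_upwards [Icc_mem_nhdsGE hε] with u hu using h u hu
  exact (h1.congr_of_eventuallyEq h2 (by simp)).derivWithin (uniqueDiffOn_Ici 0 0 (by simp))

theorem RGerm.rslope_eq {g : ℝ → ℝ} {x m : ℝ} (h : RGerm g x m) : rslope g x = m := by
  obtain ⟨ε, hε, h⟩ := h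
  exact derivWithin_of_affine hε fun u hu => by simpa using h u hu

theorem LGerm.lslope_eq {g : ℝ → ℝ} {x m : ℝ} (h : LGerm g x m) : lslope g x = m := by
  obtain ⟨ε, hε, h⟩ := h
  rw [lslope, derivWithin_of_affine (m := -m) hε fun u hu => by simp [h u hu]; ring, neg_neg]

theorem RGerm.nearby {g : ℝ → ℝ} {x m : ℝ} (h : RGerm g x m) :
    ∃ ε > 0, (∀ u ∈ Icc 0 ε, g (x + u) = g x + m * u) ∧
      ∀ u ∈ Ioo 0 ε, RGerm g (x + u) m ∧ LGerm g (x + u) m := by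
  obtain ⟨ε, hε, h⟩ := h
  refine ⟨ε, hε, h, fun u hu => ⟨⟨ε - u, by linarith [hu.2], fun w hw => ?_⟩,
    ⟨u, hu.1, fun w hw => ?_⟩⟩⟩
  · rw [add_assoc, h _ ⟨by linarith [hu.1, hw.1], by linarith [hw.2]⟩, h u ⟨hu.1.le, hu.2.le⟩]
    ring
  · rw [add_sub_assoc, h _ ⟨by linarith [hw.2], by linarith [hu.2, hw.1]⟩, h u ⟨hu.1.le, hu.2.le⟩]
    ring

theorem LGerm.nearby {g : ℝ → ℝ} {x m : ℝ} (h : LGerm g x m) :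
    ∃ ε > 0, (∀ u ∈ Icc 0 ε, g (x - u) = g x - m * u) ∧
      ∀ u ∈ Ioo 0 ε, RGerm g (x - u) m ∧ LGerm g (x - u) m := by
  obtain ⟨ε, hε, h⟩ := h
  refine ⟨ε, hε, h, fun u hu => ⟨⟨u, hu.1, fun w hw => ?_⟩,
    ⟨ε - u, by linarith [hu.2], fun w hw => ?_⟩⟩⟩
  · rw [sub_add, h _ ⟨by linarith [hw.2], by linarith [hu.2, hw.1]⟩, h u ⟨hu.1.le, hu.2.le⟩]
    ring
  · rw [sub_sub, h _ ⟨by linarith [hu.1, hw.1], by linarith [hw.2]⟩, h u ⟨hu.1.le, hu.2.le⟩]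
    ring

namespace IsPL

variable {g : ℝ → ℝ} {α β : ℝ}

theorem mono (h : IsPL g α β) {α' β' : ℝ} (hα : α ≤ α') (hβ : β' ≤ β) : IsPL g α' β' :=
  ⟨fun x hx => h.1 x ⟨hα.trans hx.1, hx.2.trans_le hβ⟩,
    fun x hx => h.2 x ⟨hα.trans_lt hx.1, hx.2.trans hβ⟩⟩

theorem rgerm (h : IsPL g α β) {x : ℝ} (hx : x ∈ Ico α β) : RGerm g x (rslope g x) := by
  obtain ⟨m, hm⟩ := h.1 x hx
  rwa [hm.rslope_eq]

theorem lgerm (h : IsPL g α β) {x : ℝ} (hx : x ∈ Ioc α β) : LGerm g x (lslope g x) := by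
  obtain ⟨m, hm⟩ := h.2 x hx
  rwa [hm.lslope_eq]

theorem exists_rslope (h : IsPL g α β) {x : ℝ} (hx : x ∈ Ico α β) : ∃ m : ℤ, rslope g x = m :=
  (h.1 x hx).imp fun _ hm => hm.rslope_eq

theorem neg (h : IsPL g α β) : IsPL (fun x => -g x) α β := by
  refine ⟨fun x hx => ?_, fun x hx => ?_⟩
  · obtain ⟨m, ε, hε, hm⟩ := h.1 x hx
    exact ⟨-m, ε, hε, fun u hu => by simp only [hm u hu]; push_cast; ring⟩
  · obtain ⟨m, ε, hε, hm⟩ := h.2 x hx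
    exact ⟨-m, ε, hε, fun u hu => by simp only [hm u hu]; push_cast; ring⟩

theorem rslope_neg (h : IsPL g α β) {x : ℝ} (hx : x ∈ Ico α β) :
    rslope (fun x => -g x) x = -rslope g x := by
  obtain ⟨ε, hε, hm⟩ := h.rgerm hx
  exact RGerm.rslope_eq ⟨ε, hε, fun u hu => by simp only [hm u hu]; ring⟩

/-- A lower bound for the slopes bounds the function from below. -/
theorem le_of_le_rslope (h : IsPL g α β) {m : ℝ} (hm : ∀ x ∈ Ico α β, m ≤ rslope g x) :
    ∀ x ∈ Icc α β, g α + m * (x - α) ≤ g x := by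
  refine Icc_induction (by simp) (fun x hx hp => ?_) fun x hx hp => ?_
  · obtain ⟨ε, hε, hg⟩ := h.rgerm hx
    refine ⟨x + ε, by linarith, fun z hz => ?_⟩
    have h1 := hg (z - x) ⟨by linarith [hz.1], by linarith [hz.2]⟩
    rw [add_sub_cancel] at h1
    have h2 := hp x ⟨hx.1, le_rfl⟩
    nlinarith [hm x hx, hz.1]
  · obtain ⟨ε, hε, hg, hgr⟩ := (h.lgerm hx).nearby
    obtain ⟨u, hu0, hu⟩ := exists_between (lt_min hε (sub_pos.2 hx.1))
    have hu1 := hu.trans_le (min_le_left _ _)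
    have hu2 := hu.trans_le (min_le_right _ _)
    have h1 := hg u ⟨hu0.le, hu1.le⟩
    have hmem : x - u ∈ Ico α x := ⟨by linarith, by linarith⟩
    have h2 := hp (x - u) hmem
    have h3 := hm (x - u) ⟨hmem.1, hmem.2.trans_le hx.2⟩
    rw [(hgr u ⟨hu0, hu1⟩).1.rslope_eq] at h3
    nlinarith

/-- An upper bound for the slopes bounds the function from above. -/
theorem le_of_rslope_le (h : IsPL g α β) {m : ℝ} (hm : ∀ x ∈ Ico α β, rslope g x ≤ m) :
    ∀ x ∈ Icc α β, g x ≤ g α + m * (x - α) := by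
  intro x hx
  have := h.neg.le_of_le_rslope (m := -m)
    (fun y hy => by rw [h.rslope_neg hy]; linarith [hm y hy]) x hx
  linarith

/-- If no slope drops at an interior point, the slopes increase from left to right. -/
theorem rslope_mono (h : IsPL g α β) (hj : ∀ x ∈ Ioo α β, lslope g x ≤ rslope g x) :
    (∀ x ∈ Ico α β, rslope g α ≤ rslope g x) ∧ ∀ x ∈ Ioc α β, rslope g α ≤ lslope g x := by
  have key : ∀ x ∈ Icc α β, (x < β → rslope g α ≤ rslope g x) ∧ (α < x → rslope g α ≤ lslope g x) := by
    refine Icc_induction (by simp) (fun x hx hp => ?_) fun x hx hp => ?_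
    · obtain ⟨ε, hε, -, hg⟩ := (h.rgerm hx).nearby
      have h1 := (hp x ⟨hx.1, le_rfl⟩).1 hx.2
      refine ⟨x + ε, by linarith, fun z hz => ?_⟩
      have h2 := hg (z - x) ⟨by linarith [hz.1], by linarith [hz.2]⟩
      rw [add_sub_cancel] at h2
      exact ⟨fun _ => by rwa [h2.1.rslope_eq], fun _ => by rwa [h2.2.lslope_eq]⟩
    · obtain ⟨ε, hε, hg, hgr⟩ := (h.lgerm hx).nearby
      obtain ⟨u, hu0, hu⟩ := exists_between (lt_min hε (sub_pos.2 hx.1))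
      have hu1 := hu.trans_le (min_le_left _ _)
      have hu2 := hu.trans_le (min_le_right _ _)
      have h1 := (hp (x - u) ⟨by linarith, by linarith⟩).1 (by linarith [hx.2])
      rw [(hgr u ⟨hu0, hu1⟩).1.rslope_eq] at h1
      exact ⟨fun hxb => h1.trans (hj x ⟨hx.1, hxb⟩), fun _ => h1⟩
  exact ⟨fun x hx => (key x ⟨hx.1, hx.2.le⟩).1 hx.2, fun x hx => (key x ⟨hx.1.le, hx.2⟩).2 hx.1⟩

/-- If no slope drops at an interior point, the function lies above its first tangent. -/
theorem tangent_le (h : IsPL g α β) (hj : ∀ x ∈ Ioo α β, lslope g x ≤ rslope g x) :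
    ∀ x ∈ Icc α β, g α + rslope g α * (x - α) ≤ g x :=
  h.le_of_le_rslope (h.rslope_mono hj).1

theorem lslope_neg (h : IsPL g α β) {x : ℝ} (hx : x ∈ Ioc α β) :
    lslope (fun x => -g x) x = -lslope g x := by
  obtain ⟨ε, hε, hm⟩ := h.lgerm hx
  exact LGerm.lslope_eq ⟨ε, hε, fun u hu => by simp only [hm u hu]; ring⟩

/-- If the slope changes at no interior point, it is the same at both ends. -/
theorem lslope_eq_rslope (h : IsPL g α β) (hαβ : α < β)
    (hj : ∀ x ∈ Ioo α β, lslope g x = rslope g x) : lslope g β = rslope g α := by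
  have hβ : β ∈ Ioc α β := ⟨hαβ, le_rfl⟩
  have h1 := (h.rslope_mono fun x hx => (hj x hx).le).2 β hβ
  have h2 := (h.neg.rslope_mono fun x hx => by
    rw [h.rslope_neg ⟨hx.1.le, hx.2⟩, h.lslope_neg ⟨hx.1, hx.2.le⟩, hj x hx]).2 β hβ
  rw [h.rslope_neg ⟨le_rfl, hαβ⟩, h.lslope_neg hβ] at h2
  linarith

/-- The changes of slope at the interior points add up to the total change of slope. -/
theorem sum_jump (h : IsPL g α β) (hαβ : α < β) (T : Finset ℝ) (hT : ∀ x ∈ T, x ∈ Ioo α β)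
    (hj : ∀ x ∈ Ioo α β, x ∉ T → lslope g x = rslope g x) :
    ∑ x ∈ T, (rslope g x - lslope g x) = lslope g β - rslope g α := by
  induction T using Finset.induction_on_max generalizing β with
  | empty => simp [h.lslope_eq_rslope hαβ fun x hx => hj x hx (by simp)]
  | insert y T hy ih =>
    have hyT : y ∉ T := fun hh => lt_irrefl _ (hy y hh)
    have hym := hT y (by simp)
    rw [Finset.sum_insert hyT, ih (h.mono le_rfl hym.2.le) hym.1
      (fun x hx => ⟨(hT x (by simp [hx])).1, hy x hx⟩)
      fun x hx hxT => hj x ⟨hx.1, hx.2.trans hym.2⟩ (by simp [hxT, hx.2.ne]),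
      (h.mono hym.1.le le_rfl).lslope_eq_rslope hym.2
      fun x hx => hj x ⟨hym.1.trans hx.1, hx.2⟩ fun hh => ?_]
    · ring
    · rcases Finset.mem_insert.1 hh with h' | h'
      · exact hx.1.ne' h'
      · exact lt_asymm hx.1 (hy x h')

/-- Finitely many affine pieces suffice. -/
theorem exists_partition {L : ℝ} (h : IsPL g 0 L) (hL : 0 ≤ L) :
    ∃ (n : ℕ) (t : ℕ → ℝ) (m : ℕ → ℤ), t 0 = 0 ∧ t n = L ∧ (∀ i < n, t i < t (i + 1)) ∧
      ∀ i < n, ∀ s ∈ Icc (t i) (t (i + 1)), g s = g (t i) + m i * (s - t i) := by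
  let p : ℝ → Prop := fun x => ∃ (n : ℕ) (t : ℕ → ℝ) (m : ℕ → ℤ), t 0 = 0 ∧ t n = x ∧
    (∀ i < n, t i < t (i + 1)) ∧ ∀ i < n, ∀ s ∈ Icc (t i) (t (i + 1)), g s = g (t i) + m i * (s - t i)
  have ext : ∀ x y : ℝ, ∀ k : ℤ, x < y → p x → (∀ s ∈ Icc x y, g s = g x + k * (s - x)) → p y := by
    rintro x y k hxy ⟨n, t, m, h0, hn, ht, hg⟩ hk
    refine ⟨n + 1, fun i => if i ≤ n then t i else y, fun i => if i < n then m i else k,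
      by simp [h0], by simp, fun i hi => ?_, fun i hi => ?_⟩
    · rcases (Nat.lt_succ_iff.1 hi).eq_or_lt with rfl | hi'
      · simpa [hn] using hxy
      · simpa [hi'.le, Nat.succ_le_of_lt hi'] using ht i hi'
    · rcases (Nat.lt_succ_iff.1 hi).eq_or_lt with rfl | hi'
      · simpa [hn] using hk
      · simpa [hi', hi'.le, Nat.succ_le_of_lt hi'] using hg i hi'
  refine Icc_induction (p := p) ⟨0, fun _ => 0, fun _ => 0, rfl, rfl, by simp, by simp⟩
    (fun x hx hp => ?_) (fun x hx hp => ?_) L ⟨hL, le_rfl⟩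
  · obtain ⟨k, ε, hε, hk⟩ := h.1 x hx
    refine ⟨x + ε, by linarith, fun z hz => ext x z k hz.1 (hp x ⟨hx.1, le_rfl⟩) fun s hs => ?_⟩
    simpa using hk (s - x) ⟨by linarith [hs.1], by linarith [hs.2, hz.2]⟩
  · obtain ⟨k, ε, hε, hk⟩ := h.2 x hx
    have hy : x - min ε x < x := by linarith [lt_min hε hx.1]
    have hy0 : 0 ≤ x - min ε x := by linarith [min_le_right ε x]
    refine ext _ x k hy (hp _ ⟨hy0, hy⟩) fun s hs => ?_
    have h1 := hk (x - s) ⟨by linarith [hs.2], by linarith [hs.1, min_le_left ε x]⟩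
    have h2 := hk (min ε x) ⟨(lt_min hε hx.1).le, min_le_left _ _⟩
    rw [sub_sub_cancel] at h1
    rw [h1, h2]
    ring

theorem continuousOn (h : IsPL g α β) : ContinuousOn g (Icc α β) := by
  have hR : ∀ x ∈ Ico α β, ContinuousWithinAt g (Ici x) x := fun x hx => by
    obtain ⟨ε, hε, hm⟩ := h.rgerm hx
    have h1 : ContinuousWithinAt (fun y => g x + rslope g x * (y - x)) (Ici x) x := by fun_prop
    refine h1.congr_of_eventuallyEq ?_ (by simp)
    filter_upwards [Icc_mem_nhdsGE (show x < x + ε by linarith)] with y hy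
    simpa using hm (y - x) ⟨by linarith [hy.1], by linarith [hy.2]⟩
  have hL : ∀ x ∈ Ioc α β, ContinuousWithinAt g (Iic x) x := fun x hx => by
    obtain ⟨ε, hε, hm⟩ := h.lgerm hx
    have h1 : ContinuousWithinAt (fun y => g x - lslope g x * (x - y)) (Iic x) x := by fun_prop
    refine h1.congr_of_eventuallyEq ?_ (by simp)
    filter_upwards [Icc_mem_nhdsLE (show x - ε < x by linarith)] with y hy
    simpa using hm (x - y) ⟨by linarith [hy.2], by linarith [hy.1]⟩
  intro x hx
  rcases hx.1.eq_or_lt with rfl | h1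
  · rcases hx.2.eq_or_lt with rfl | h2
    · simp
    · exact (hR α ⟨le_rfl, h2⟩).mono Icc_subset_Ici_self
  · rcases hx.2.eq_or_lt with rfl | h2
    · exact (hL x ⟨h1, le_rfl⟩).mono Icc_subset_Iic_self
    · have := (hL x ⟨h1, h2.le⟩).union (hR x ⟨h1.le, h2⟩)
      rw [Iic_union_Ici, continuousWithinAt_univ] at this
      exact this.continuousWithinAt

end IsPL

/-! ### Germs of the distance to a closed set of reals -/

/-- At a point of `C` next to a gap in the direction `σ = ±1`, the distance to `C` grows with slope `1`
up to the middle of the gap. -/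
theorem infDist_of_mem {C : Set ℝ} {t σ δ : ℝ} (hσ : σ = 1 ∨ σ = -1) (ht : t ∈ C)
    (hgap : ∀ u ∈ Ioc 0 δ, t + σ * u ∉ C) {u : ℝ} (hu : u ∈ Icc 0 (δ / 2)) :
    Metric.infDist (t + σ * u) C = u := by
  have hσ' : |σ| = 1 := by rcases hσ with rfl | rfl <;> simp
  have hσ2 : σ * σ = 1 := by rcases hσ with rfl | rfl <;> simp
  refine le_antisymm ?_ ((Metric.le_infDist ⟨t, ht⟩).2 fun c hc => ?_)
  · refine (Metric.infDist_le_dist_of_mem ht).trans_eq ?_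
    rw [Real.dist_eq, add_sub_cancel_left, abs_mul, hσ', one_mul, abs_of_nonneg hu.1]
  · by_contra! hlt
    have h1 : dist (t + σ * u) c = |u - σ * (c - t)| := by
      rw [Real.dist_eq, show t + σ * u - c = σ * (u - σ * (c - t)) by linear_combination (c - t) * hσ2,
        abs_mul, hσ', one_mul]
    rw [h1, abs_lt] at hlt
    refine hgap (σ * (c - t)) ⟨by linarith [hlt.2], by linarith [hlt.1, hu.2]⟩ ?_
    rwa [show t + σ * (σ * (c - t)) = c by linear_combination (c - t) * hσ2]

/-- Moving towards a nearest point of `C` decreases the distance with slope `1`. -/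
theorem infDist_toward {C : Set ℝ} {t σ : ℝ} (hσ : σ = 1 ∨ σ = -1)
    (h : t + σ * Metric.infDist t C ∈ C) {u : ℝ} (hu : u ∈ Icc 0 (Metric.infDist t C)) :
    Metric.infDist (t + σ * u) C = Metric.infDist t C - u := by
  have hσ' : |σ| = 1 := by rcases hσ with rfl | rfl <;> simp
  refine le_antisymm ?_ ?_
  · refine (Metric.infDist_le_dist_of_mem h).trans_eq ?_
    rw [Real.dist_eq, show t + σ * u - (t + σ * Metric.infDist t C) =
      σ * (u - Metric.infDist t C) by ring, abs_mul, hσ', one_mul, abs_sub_comm,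
      abs_of_nonneg (by linarith [hu.2])]
  · have h1 := Metric.infDist_le_infDist_add_dist (s := C) (x := t) (y := t + σ * u)
    rw [Real.dist_eq, show t - (t + σ * u) = -(σ * u) by ring, abs_neg, abs_mul, hσ', one_mul,
      abs_of_nonneg hu.1] at h1
    linarith

/-- Moving in a direction in which there is no nearest point of `C` increases the distance with slope
`1`. -/
theorem infDist_away {C : Set ℝ} (hC : IsClosed C) (hne : C.Nonempty) {t σ : ℝ}
    (hσ : σ = 1 ∨ σ = -1) (h : t + σ * Metric.infDist t C ∉ C) :
    ∃ ε > 0, ∀ u ∈ Icc 0 ε, Metric.infDist (t + σ * u) C = Metric.infDist t C + u := by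
  have hσ' : |σ| = 1 := by rcases hσ with rfl | rfl <;> simp
  have hσ2 : σ * σ = 1 := by rcases hσ with rfl | rfl <;> simp
  set δ := Metric.infDist t C with hδ
  obtain ⟨η, hη, hball⟩ := Metric.isOpen_iff.1 hC.isOpen_compl _ h
  refine ⟨η / 2, half_pos hη, fun u hu => le_antisymm ?_ ((Metric.le_infDist hne).2 fun c hc => ?_)⟩
  · have h1 := Metric.infDist_le_infDist_add_dist (s := C) (x := t + σ * u) (y := t)
    rwa [Real.dist_eq, add_sub_cancel_left, abs_mul, hσ', one_mul, abs_of_nonneg hu.1] at h1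
  · set w := σ * (c - t) with hw
    have hcw : c = t + σ * w := by linear_combination -(c - t) * hσ2
    have h1 : dist (t + σ * u) c = |u - w| := by
      rw [Real.dist_eq, hcw, show t + σ * u - (t + σ * w) = σ * (u - w) by ring,
        abs_mul, hσ', one_mul]
    have h2 : δ ≤ |w| := by
      have := Metric.infDist_le_dist_of_mem (x := t) hc
      rwa [Real.dist_eq, hcw, show t - (t + σ * w) = -(σ * w) by ring, abs_neg, abs_mul, hσ',
        one_mul] at this
    have h3 : η ≤ |w - δ| := by
      by_contra! hlt
      refine hball (a := c) ?_ hc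
      rwa [Metric.mem_ball, Real.dist_eq, hcw, show t + σ * w - (t + σ * δ) = σ * (w - δ) by ring,
        abs_mul, hσ', one_mul]
    rw [h1]
    have hδ0 : 0 ≤ δ := Metric.infDist_nonneg
    rcases le_abs.1 h2 with h2 | h2
    · rw [abs_of_nonneg (by linarith)] at h3
      rw [abs_sub_comm]
      exact le_trans (by linarith [hu.2]) (le_abs_self _)
    · exact le_trans (by linarith) (le_abs_self _)

/-- The distance to a closed set of reals has germs of slopes `±1` outside the set, and no convex
kink there. -/
theorem exists_germs_infDist {C : Set ℝ} (hC : IsClosed C) (hne : C.Nonempty) {t : ℝ} (ht : t ∉ C) :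
    ∃ m k : ℤ, m + k ≤ 0 ∧
      (∃ ε > 0, ∀ u ∈ Icc 0 ε, Metric.infDist (t + 1 * u) C = Metric.infDist t C + m * u) ∧
      ∃ ε > 0, ∀ u ∈ Icc 0 ε, Metric.infDist (t + -1 * u) C = Metric.infDist t C + k * u := by
  have hpos : 0 < Metric.infDist t C := (hC.notMem_iff_infDist_pos hne).1 ht
  have hto : ∀ σ : ℝ, σ = 1 ∨ σ = -1 → t + σ * Metric.infDist t C ∈ C →
      ∃ ε > 0, ∀ u ∈ Icc 0 ε, Metric.infDist (t + σ * u) C = Metric.infDist t C + ((-1 : ℤ) : ℝ) * u :=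
    fun σ hσ h => ⟨_, hpos, fun u hu => by rw [infDist_toward hσ h hu]; push_cast; ring⟩
  have haw : ∀ σ : ℝ, σ = 1 ∨ σ = -1 → t + σ * Metric.infDist t C ∉ C →
      ∃ ε > 0, ∀ u ∈ Icc 0 ε, Metric.infDist (t + σ * u) C = Metric.infDist t C + ((1 : ℤ) : ℝ) * u :=
    fun σ hσ h => (infDist_away hC hne hσ h).imp fun ε hε => ⟨hε.1, fun u hu => by
      rw [hε.2 u hu]; push_cast; ring⟩
  by_cases h1 : t + 1 * Metric.infDist t C ∈ C
  · by_cases h2 : t + -1 * Metric.infDist t C ∈ C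
    · exact ⟨-1, -1, by norm_num, hto _ (Or.inl rfl) h1, hto _ (Or.inr rfl) h2⟩
    · exact ⟨-1, 1, by norm_num, hto _ (Or.inl rfl) h1, haw _ (Or.inr rfl) h2⟩
  · have h2 : t + -1 * Metric.infDist t C ∈ C := by
      obtain ⟨c, hc, h⟩ := hC.exists_infDist_eq_dist hne t
      rw [Real.dist_eq] at h
      rcases abs_choice (t - c) with h' | h'
      · convert hc using 1; rw [h, h']; ring
      · refine absurd ?_ h1
        convert hc using 1; rw [h, h']; ring
    exact ⟨1, -1, by norm_num, haw _ (Or.inl rfl) h1, hto _ (Or.inr rfl) h2⟩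

namespace MetricGraph

variable {V E : Type*} {Γ : MetricGraph V E}

/-! ### Tangent directions and rays -/

theorem edgePt_of_nonpos (e : E) {t : ℝ} (h : t ≤ 0) : Γ.edgePt e t = .vertex (Γ.src e) := by
  simp [edgePt, h]

theorem edgePt_of_len_le (e : E) {t : ℝ} (h : Γ.len e ≤ t) : Γ.edgePt e t = .vertex (Γ.tgt e) := by
  simp [edgePt, h, (Γ.len_pos e).trans_le h]

theorem edgePt_of_mem (e : E) {t : ℝ} (h : t ∈ Ioo 0 (Γ.len e)) :
    Γ.edgePt e t = .inner e t h.1 h.2 := by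
  simp [edgePt, not_le.2 h.1, not_le.2 h.2]

theorem edgePt_zero (e : E) : Γ.edgePt e 0 = .vertex (Γ.src e) := edgePt_of_nonpos e le_rfl

theorem edgePt_len (e : E) : Γ.edgePt e (Γ.len e) = .vertex (Γ.tgt e) := edgePt_of_len_le e le_rfl

theorem continuous_edgePt (e : E) : Continuous (Γ.edgePt e) :=
  continuous_iff_coinduced_le.2 (le_iSup (fun e => TopologicalSpace.coinduced (Γ.edgePt e) _) e)

theorem continuous_of_edges {Y : Type*} [TopologicalSpace Y] {f : Γ.Point → Y}
    (h : ∀ e, Continuous fun t => f (Γ.edgePt e t)) : Continuous f :=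
  continuous_iSup_dom.2 fun e => continuous_coinduced_dom.2 (h e)

theorem continuous_ray (d : Γ.Dir) : Continuous (Γ.ray d) := by
  cases d with
  | fwd e t ht => exact (continuous_edgePt e).comp (by fun_prop : Continuous fun s => t + s)
  | bwd e t ht => exact (continuous_edgePt e).comp (by fun_prop : Continuous fun s => t - s)

namespace Dir

/-- The distance from the base point of a direction to the end of its edge in that direction. -/
def length : Γ.Dir → ℝ
  | .fwd e t _ => Γ.len e - t
  | .bwd _ t _ => t

theorem length_pos (d : Γ.Dir) : 0 < d.length := by
  cases d with
  | fwd e t ht => exact sub_pos.2 ht.2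
  | bwd e t ht => exact ht.1

/-- The direction `d` moved forward by `s` along its ray. -/
def adv : (d : Γ.Dir) → (s : ℝ) → s ∈ Ico 0 d.length → Γ.Dir
  | .fwd e t ht, s, hs => .fwd e (t + s) ⟨add_nonneg ht.1 hs.1, lt_sub_iff_add_lt'.1 hs.2⟩
  | .bwd e t ht, s, hs => .bwd e (t - s) ⟨sub_pos.2 hs.2, (sub_le_self _ hs.1).trans ht.2⟩

/-- The direction at `Γ.ray d s` pointing back to the base of `d`. -/
def rev : (d : Γ.Dir) → (s : ℝ) → s ∈ Ioc 0 d.length → Γ.Dir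
  | .fwd e t ht, s, hs => .bwd e (t + s) ⟨add_pos_of_nonneg_of_pos ht.1 hs.1, le_sub_iff_add_le'.1 hs.2⟩
  | .bwd e t ht, s, hs => .fwd e (t - s) ⟨sub_nonneg.2 hs.2, (sub_lt_self _ hs.1).trans_le ht.2⟩

theorem length_adv (d : Γ.Dir) {s : ℝ} (hs : s ∈ Ico 0 d.length) :
    (d.adv s hs).length = d.length - s := by
  cases d <;> simp only [adv, length]
  ring

theorem le_length_rev (d : Γ.Dir) {s : ℝ} (hs : s ∈ Ioc 0 d.length) : s ≤ (d.rev s hs).length := by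
  cases d with
  | fwd e t ht => simpa [rev, length] using ht.1
  | bwd e t ht => simp only [rev, length]; linarith [ht.2]

end Dir

theorem ray_adv (d : Γ.Dir) {s : ℝ} (hs : s ∈ Ico 0 d.length) (u : ℝ) :
    Γ.ray (d.adv s hs) u = Γ.ray d (s + u) := by
  cases d <;> simp only [Dir.adv, ray]
  · rw [add_assoc]
  · rw [sub_sub]

theorem ray_rev (d : Γ.Dir) {s : ℝ} (hs : s ∈ Ioc 0 d.length) (u : ℝ) :
    Γ.ray (d.rev s hs) u = Γ.ray d (s - u) := by
  cases d <;> simp only [Dir.rev, ray]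
  · rw [add_sub_assoc]
  · rw [← sub_add]

theorem base_adv (d : Γ.Dir) {s : ℝ} (hs : s ∈ Ico 0 d.length) :
    Γ.base (d.adv s hs) = Γ.ray d s := by rw [base, ray_adv, add_zero]

theorem base_rev (d : Γ.Dir) {s : ℝ} (hs : s ∈ Ioc 0 d.length) :
    Γ.base (d.rev s hs) = Γ.ray d s := by rw [base, ray_rev, sub_zero]

theorem ray_zero (d : Γ.Dir) : Γ.ray d 0 = Γ.base d := rfl

theorem eq_of_edgePt_eq {e e' : E} {s t : ℝ} (hs : s ∈ Ioo 0 (Γ.len e))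
    (h : Γ.edgePt e' t = Γ.edgePt e s) : e' = e ∧ t = s := by
  rw [edgePt_of_mem e hs] at h
  unfold edgePt at h
  split_ifs at h
  simpa using h

theorem edgePt_ne_vertex {e : E} {s : ℝ} (hs : s ∈ Ioo 0 (Γ.len e)) (v : V) :
    Γ.edgePt e s ≠ .vertex v := by
  rw [edgePt_of_mem e hs]; simp

/-- The ray of a direction is injective, except that both ends may be the same vertex. -/
theorem ray_injOn (d : Γ.Dir) {s t : ℝ} (hs : s ∈ Ioo 0 d.length) (ht : t ∈ Icc 0 d.length)
    (h : Γ.ray d t = Γ.ray d s) : t = s := by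
  cases d with
  | fwd e x hx =>
    have := (eq_of_edgePt_eq (s := x + s)
      ⟨by linarith [hx.1, hs.1], lt_sub_iff_add_lt'.1 hs.2⟩ h).2
    linarith
  | bwd e x hx =>
    have := (eq_of_edgePt_eq (s := x - s) ⟨sub_pos.2 hs.2, by linarith [hx.2, hs.1]⟩ h).2
    linarith

theorem eq_adv_or_rev (d : Γ.Dir) {s : ℝ} (hs : s ∈ Ioo 0 d.length) {d' : Γ.Dir}
    (h : Γ.base d' = Γ.ray d s) :
    d' = d.adv s (Ioo_subset_Ico_self hs) ∨ d' = d.rev s (Ioo_subset_Ioc_self hs) := by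
  cases d with
  | fwd e x hx =>
    have hm : x + s ∈ Ioo 0 (Γ.len e) := ⟨by linarith [hx.1, hs.1], lt_sub_iff_add_lt'.1 hs.2⟩
    cases d' with
    | fwd e' x' hx' =>
      obtain ⟨rfl, h'⟩ := eq_of_edgePt_eq hm h
      rw [add_zero] at h'; subst h'; exact Or.inl rfl
    | bwd e' x' hx' =>
      obtain ⟨rfl, h'⟩ := eq_of_edgePt_eq hm h
      rw [sub_zero] at h'; subst h'; exact Or.inr rfl
  | bwd e x hx =>
    have hm : x - s ∈ Ioo 0 (Γ.len e) := ⟨sub_pos.2 hs.2, by linarith [hx.2, hs.1]⟩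
    cases d' with
    | fwd e' x' hx' =>
      obtain ⟨rfl, h'⟩ := eq_of_edgePt_eq hm h
      rw [add_zero] at h'; subst h'; exact Or.inr rfl
    | bwd e' x' hx' =>
      obtain ⟨rfl, h'⟩ := eq_of_edgePt_eq hm h
      rw [sub_zero] at h'; subst h'; exact Or.inl rfl

theorem adv_ne_rev (d : Γ.Dir) {s : ℝ} (hs : s ∈ Ioo 0 d.length) :
    d.adv s (Ioo_subset_Ico_self hs) ≠ d.rev s (Ioo_subset_Ioc_self hs) := by
  cases d <;> simp [Dir.adv, Dir.rev]

theorem finite_dirs [Finite E] (P : Γ.Point) : {d : Γ.Dir | Γ.base d = P}.Finite := by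
  let F : Γ.Dir → E × Bool := fun d => match d with
    | .fwd e _ _ => (e, true)
    | .bwd e _ _ => (e, false)
  refine Set.Finite.of_finite_image (f := F) (Set.toFinite _) fun d hd d' hd' h => ?_
  cases d with
  | fwd e x hx =>
    cases d' with
    | fwd e' x' hx' =>
      obtain rfl : e = e' := by simpa [F] using h
      have h1 : Γ.edgePt e x = Γ.edgePt e x' := by
        simpa [base, ray] using (hd : _ = P).trans (hd' : _ = P).symm
      suffices x = x' by subst this; rfl
      rcases hx.1.eq_or_lt with rfl | h2
      · rcases hx'.1.eq_or_lt with rfl | h3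
        · rfl
        · exact (eq_of_edgePt_eq ⟨h3, hx'.2⟩ h1).2
      · exact (eq_of_edgePt_eq ⟨h2, hx.2⟩ h1.symm).2.symm
    | bwd e' x' hx' => simp [F] at h
  | bwd e x hx =>
    cases d' with
    | bwd e' x' hx' =>
      obtain rfl : e = e' := by simpa [F] using h
      have h1 : Γ.edgePt e x = Γ.edgePt e x' := by
        simpa [base, ray] using (hd : _ = P).trans (hd' : _ = P).symm
      suffices x = x' by subst this; rfl
      rcases hx.2.eq_or_lt with rfl | h2
      · rcases hx'.2.eq_or_lt with rfl | h3
        · rfl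
        · exact (eq_of_edgePt_eq ⟨hx'.1, h3⟩ h1).2
      · exact (eq_of_edgePt_eq ⟨hx.1, h2⟩ h1.symm).2.symm
    | fwd e' x' hx' => simp [F] at h

/-- The finite set of tangent directions at a point. -/
noncomputable def dirs [Finite E] (P : Γ.Point) : Finset Γ.Dir := (finite_dirs P).toFinset

@[simp] theorem mem_dirs [Finite E] {P : Γ.Point} {d : Γ.Dir} : d ∈ dirs P ↔ Γ.base d = P := by
  simp [dirs]

theorem ord_eq_sum [Finite E] (f : Γ.Point → ℝ) (P : Γ.Point) :
    Γ.ord f P = ∑ d ∈ dirs P, Γ.slope f d := by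
  rw [ord]
  exact finsum_mem_eq_finite_toFinset_sum _ (finite_dirs P)

/-- A point in the interior of an edge has two tangent directions. -/
theorem ord_ray [Finite E] (f : Γ.Point → ℝ) (d : Γ.Dir) {s : ℝ} (hs : s ∈ Ioo 0 d.length) :
    Γ.ord f (Γ.ray d s) = Γ.slope f (d.adv s (Ioo_subset_Ico_self hs)) +
      Γ.slope f (d.rev s (Ioo_subset_Ioc_self hs)) := by
  classical
  have : dirs (Γ.ray d s) = {d.adv s (Ioo_subset_Ico_self hs), d.rev s (Ioo_subset_Ioc_self hs)} := by
    ext d'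
    simp only [mem_dirs, Finset.mem_insert, Finset.mem_singleton]
    refine ⟨eq_adv_or_rev d hs, ?_⟩
    rintro (rfl | rfl)
    · exact base_adv _ _
    · exact base_rev _ _
  rw [ord_eq_sum, this, Finset.sum_pair (adv_ne_rev d hs)]

theorem slope_eq_rslope (f : Γ.Point → ℝ) (d : Γ.Dir) :
    Γ.slope f d = rslope (fun s => f (Γ.ray d s)) 0 := by
  simp [slope, rslope]

theorem slope_adv (f : Γ.Point → ℝ) (d : Γ.Dir) {s : ℝ} (hs : s ∈ Ico 0 d.length) :
    Γ.slope f (d.adv s hs) = rslope (fun s => f (Γ.ray d s)) s := by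
  simp [slope, rslope, ray_adv]

theorem slope_rev (f : Γ.Point → ℝ) (d : Γ.Dir) {s : ℝ} (hs : s ∈ Ioc 0 d.length) :
    Γ.slope f (d.rev s hs) = -lslope (fun s => f (Γ.ray d s)) s := by
  simp [slope, lslope, ray_rev]

theorem ord_ray_eq_jump [Finite E] (f : Γ.Point → ℝ) (d : Γ.Dir) {s : ℝ} (hs : s ∈ Ioo 0 d.length) :
    Γ.ord f (Γ.ray d s) =
      rslope (fun s => f (Γ.ray d s)) s - lslope (fun s => f (Γ.ray d s)) s := by
  rw [ord_ray f d hs, slope_adv, slope_rev, sub_eq_add_neg]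

/-! ### Rational functions through their germs -/

/-- Near its base point, `f` is affine with slope `m` along the direction `d`. -/
def HasGerm (f : Γ.Point → ℝ) (d : Γ.Dir) (m : ℝ) : Prop :=
  ∃ ε > 0, ∀ s ∈ Icc 0 ε, f (Γ.ray d s) = f (Γ.base d) + m * s

theorem HasGerm.slope_eq {f : Γ.Point → ℝ} {d : Γ.Dir} {m : ℝ} (h : HasGerm f d m) :
    Γ.slope f d = m := by
  obtain ⟨ε, hε, h⟩ := h
  exact derivWithin_of_affine hε fun u hu => h u hu

theorem exists_index_le_lt {t : ℕ → ℝ} {n : ℕ} {x : ℝ} (h0 : t 0 ≤ x) (hn : x < t n) :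
    ∃ i < n, t i ≤ x ∧ x < t (i + 1) := by
  induction n with
  | zero => linarith
  | succ n ih =>
    by_cases h : x < t n
    · obtain ⟨i, hi, h⟩ := ih h
      exact ⟨i, by omega, h⟩
    · exact ⟨n, by omega, not_lt.1 h, hn⟩

theorem exists_index_lt_le {t : ℕ → ℝ} {n : ℕ} {x : ℝ} (h0 : t 0 < x) (hn : x ≤ t n) :
    ∃ i < n, t i < x ∧ x ≤ t (i + 1) := by
  induction n with
  | zero => linarith
  | succ n ih =>
    by_cases h : x ≤ t n
    · obtain ⟨i, hi, h⟩ := ih h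
      exact ⟨i, by omega, h⟩
    · exact ⟨n, by omega, not_le.1 h, hn⟩

theorem isPL_ray {f : Γ.Point → ℝ} (h : ∀ d : Γ.Dir, ∃ m : ℤ, HasGerm f d m) (d : Γ.Dir) :
    IsPL (fun s => f (Γ.ray d s)) 0 d.length := by
  refine ⟨fun x hx => ?_, fun x hx => ?_⟩
  · obtain ⟨m, ε, hε, hm⟩ := h (d.adv x hx)
    exact ⟨m, ε, hε, fun u hu => by simpa only [ray_adv, base_adv] using hm u hu⟩
  · obtain ⟨m, ε, hε, hm⟩ := h (d.rev x hx)
    refine ⟨-m, ε, hε, fun u hu => ?_⟩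
    have := hm u hu
    simp only [ray_rev, base_rev] at this
    simp only [this]; push_cast; ring

theorem isPL_edge {f : Γ.Point → ℝ} (h : ∀ d : Γ.Dir, ∃ m : ℤ, HasGerm f d m) (e : E) :
    IsPL (fun s => f (Γ.edgePt e s)) 0 (Γ.len e) := by
  simpa [Dir.length, ray] using isPL_ray h (.fwd e 0 ⟨le_rfl, Γ.len_pos e⟩)

/-- A function is rational if and only if it has a germ of integer slope along every direction:
continuity and the finiteness of the number of linear parts follow by compactness of the edges. -/
theorem isRational_iff {f : Γ.Point → ℝ} :
    Γ.IsRational f ↔ ∀ d : Γ.Dir, ∃ m : ℤ, HasGerm f d m := by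
  constructor
  · rintro ⟨-, h⟩ d
    cases d with
    | fwd e x hx =>
      obtain ⟨n, t, m, h0, hn, ht, hf⟩ := h e
      obtain ⟨i, hi, h1, h2⟩ := exists_index_le_lt (x := x) (t := t) (n := n) (by rw [h0]; exact hx.1)
        (by rw [hn]; exact hx.2)
      refine ⟨m i, t (i + 1) - x, by linarith, fun s hs => ?_⟩
      simp only [base, ray, add_zero]
      rw [hf i hi (x + s) ⟨by linarith [hs.1], by linarith [hs.2]⟩, hf i hi x ⟨h1, h2.le⟩]
      ring
    | bwd e x hx =>
      obtain ⟨n, t, m, h0, hn, ht, hf⟩ := h e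
      obtain ⟨i, hi, h1, h2⟩ := exists_index_lt_le (x := x) (t := t) (n := n) (by rw [h0]; exact hx.1)
        (by rw [hn]; exact hx.2)
      refine ⟨-m i, x - t i, by linarith, fun s hs => ?_⟩
      simp only [base, ray, sub_zero]
      rw [hf i hi (x - s) ⟨by linarith [hs.2], by linarith [hs.1]⟩, hf i hi x ⟨h1.le, h2⟩]
      push_cast
      ring
  · intro h
    refine ⟨continuous_of_edges fun e => ?_, fun e => ?_⟩
    · have h1 : ∀ t, f (Γ.edgePt e t) = f (Γ.edgePt e (max 0 (min (Γ.len e) t))) := fun t => by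
        rcases le_total t 0 with h0 | h0
        · rw [max_eq_left ((min_le_right _ _).trans h0), edgePt_zero, edgePt_of_nonpos e h0]
        · rcases le_total (Γ.len e) t with h1 | h1
          · rw [min_eq_left h1, max_eq_right (Γ.len_pos e).le, edgePt_len, edgePt_of_len_le e h1]
          · rw [min_eq_right h1, max_eq_right h0]
      rw [funext h1]
      exact (isPL_edge h e).continuousOn.comp_continuous (f := fun t => max 0 (min (Γ.len e) t))
        (by fun_prop) fun t => ⟨le_max_left _ _, max_le (Γ.len_pos e).le (min_le_left _ _)⟩
    · exact (isPL_edge h e).exists_partition (Γ.len_pos e).le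

theorem IsRational.isPL {f : Γ.Point → ℝ} (h : Γ.IsRational f) (d : Γ.Dir) :
    IsPL (fun s => f (Γ.ray d s)) 0 d.length := isPL_ray (isRational_iff.1 h) d

theorem IsRational.hasGerm {f : Γ.Point → ℝ} (h : Γ.IsRational f) (d : Γ.Dir) :
    HasGerm f d (Γ.slope f d) := by
  obtain ⟨m, hm⟩ := isRational_iff.1 h d
  rwa [hm.slope_eq]

theorem IsRational.exists_slope {f : Γ.Point → ℝ} (h : Γ.IsRational f) (d : Γ.Dir) :
    ∃ m : ℤ, Γ.slope f d = m := (isRational_iff.1 h d).imp fun _ hm => hm.slope_eq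

theorem HasGerm.add {f g : Γ.Point → ℝ} {d : Γ.Dir} {m k : ℝ} (hf : HasGerm f d m)
    (hg : HasGerm g d k) : HasGerm (fun x => f x + g x) d (m + k) := by
  obtain ⟨ε, hε, hf⟩ := hf
  obtain ⟨δ, hδ, hg⟩ := hg
  refine ⟨min ε δ, lt_min hε hδ, fun s hs => ?_⟩
  simp only [hf s ⟨hs.1, hs.2.trans (min_le_left _ _)⟩, hg s ⟨hs.1, hs.2.trans (min_le_right _ _)⟩]
  ring

theorem HasGerm.neg {f : Γ.Point → ℝ} {d : Γ.Dir} {m : ℝ} (hf : HasGerm f d m) :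
    HasGerm (fun x => -f x) d (-m) := by
  obtain ⟨ε, hε, hf⟩ := hf
  refine ⟨ε, hε, fun s hs => ?_⟩
  simp only [hf s hs]
  ring

theorem hasGerm_const (c : ℝ) (d : Γ.Dir) : HasGerm (fun _ : Γ.Point => c) d 0 :=
  ⟨1, one_pos, fun s _ => by simp⟩

theorem IsRational.add {f g : Γ.Point → ℝ} (hf : Γ.IsRational f) (hg : Γ.IsRational g) :
    Γ.IsRational fun x => f x + g x := by
  refine isRational_iff.2 fun d => ?_
  obtain ⟨m, hm⟩ := isRational_iff.1 hf d
  obtain ⟨k, hk⟩ := isRational_iff.1 hg d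
  exact ⟨m + k, by simpa using hm.add hk⟩

theorem IsRational.neg {f : Γ.Point → ℝ} (hf : Γ.IsRational f) : Γ.IsRational fun x => -f x := by
  refine isRational_iff.2 fun d => ?_
  obtain ⟨m, hm⟩ := isRational_iff.1 hf d
  exact ⟨-m, by simpa using hm.neg⟩

theorem isRational_const (c : ℝ) : Γ.IsRational fun _ => c :=
  isRational_iff.2 fun d => ⟨0, by simpa using hasGerm_const c d⟩

theorem IsRational.ord_add [Finite E] {f g : Γ.Point → ℝ} (hf : Γ.IsRational f)
    (hg : Γ.IsRational g) (P : Γ.Point) :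
    Γ.ord (fun x => f x + g x) P = Γ.ord f P + Γ.ord g P := by
  simp only [ord_eq_sum, ← Finset.sum_add_distrib]
  exact Finset.sum_congr rfl fun d _ => ((hf.hasGerm d).add (hg.hasGerm d)).slope_eq

theorem IsRational.ord_neg [Finite E] {f : Γ.Point → ℝ} (hf : Γ.IsRational f) (P : Γ.Point) :
    Γ.ord (fun x => -f x) P = -Γ.ord f P := by
  simp only [ord_eq_sum, ← Finset.sum_neg_distrib]
  exact Finset.sum_congr rfl fun d _ => (hf.hasGerm d).neg.slope_eq

theorem ord_const [Finite E] (c : ℝ) (P : Γ.Point) : Γ.ord (fun _ : Γ.Point => c) P = 0 := by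
  rw [ord_eq_sum]
  exact Finset.sum_eq_zero fun d _ => (hasGerm_const c d).slope_eq

theorem IsRational.exists_ord [Finite E] {f : Γ.Point → ℝ} (hf : Γ.IsRational f) (P : Γ.Point) :
    ∃ m : ℤ, Γ.ord f P = m := by
  choose m hm using hf.exists_slope
  exact ⟨∑ d ∈ dirs P, m d, by simp [ord_eq_sum, hm]⟩

theorem LinEquiv.symm [Finite E] {D D' : Γ.Divisor} (h : Γ.LinEquiv D D') : Γ.LinEquiv D' D := by
  obtain ⟨f, hf, h⟩ := h
  exact ⟨_, hf.neg, fun P => by rw [hf.ord_neg, h]; ring⟩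

theorem LinEquiv.trans [Finite E] {D D' D'' : Γ.Divisor} (h : Γ.LinEquiv D D')
    (h' : Γ.LinEquiv D' D'') : Γ.LinEquiv D D'' := by
  obtain ⟨f, hf, h⟩ := h
  obtain ⟨f', hf', h'⟩ := h'
  exact ⟨_, hf.add hf', fun P => by rw [hf.ord_add hf', h, h']; ring⟩

/-- At a maximum no slope is positive. -/
theorem IsRational.slope_nonpos {f : Γ.Point → ℝ} (hf : Γ.IsRational f) (d : Γ.Dir)
    (hmax : ∀ x, f x ≤ f (Γ.base d)) : Γ.slope f d ≤ 0 := by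
  obtain ⟨ε, hε, h⟩ := hf.hasGerm d
  have h1 := h ε ⟨hε.le, le_rfl⟩
  have h2 := hmax (Γ.ray d ε)
  by_contra! h3
  nlinarith

theorem IsRational.slope_nonneg {f : Γ.Point → ℝ} (hf : Γ.IsRational f) (d : Γ.Dir)
    (hmin : ∀ x, f (Γ.base d) ≤ f x) : 0 ≤ Γ.slope f d := by
  obtain ⟨ε, hε, h⟩ := hf.hasGerm d
  have h1 := h ε ⟨hε.le, le_rfl⟩
  have h2 := hmin (Γ.ray d ε)
  by_contra! h3
  nlinarith

theorem IsRational.ord_nonpos [Finite E] {f : Γ.Point → ℝ} (hf : Γ.IsRational f) {P : Γ.Point}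
    (hmax : ∀ x, f x ≤ f P) : Γ.ord f P ≤ 0 := by
  rw [ord_eq_sum]
  exact Finset.sum_nonpos fun d hd => hf.slope_nonpos d (by rwa [mem_dirs.1 hd])

theorem IsRational.ord_nonneg [Finite E] {f : Γ.Point → ℝ} (hf : Γ.IsRational f) {P : Γ.Point}
    (hmin : ∀ x, f P ≤ f x) : 0 ≤ Γ.ord f P := by
  rw [ord_eq_sum]
  exact Finset.sum_nonneg fun d hd => hf.slope_nonneg d (by rwa [mem_dirs.1 hd])

/-- Every direction starts with a stretch whose interior avoids a given finite set, here the
support of a divisor. -/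
theorem exists_free (D : Γ.Divisor) (d : Γ.Dir) :
    ∃ ρ > 0, ρ ≤ d.length ∧ ∀ u ∈ Ioo 0 ρ, D (Γ.ray d u) = 0 := by
  have hfin : {u | u ∈ Ioo 0 d.length ∧ D (Γ.ray d u) ≠ 0}.Finite := by
    refine Set.Finite.of_finite_image (f := Γ.ray d)
      (D.support.finite_toSet.subset ?_) fun u hu w hw h => ?_
    · rintro _ ⟨u, hu, rfl⟩
      exact Finsupp.mem_support_iff.2 hu.2
    · exact ray_injOn d hw.1 ⟨hu.1.1.le, hu.1.2.le⟩ h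
  have h1 : ∀ᶠ u in 𝓝[>] (0 : ℝ), u ∉ {u | u ∈ Ioo 0 d.length ∧ D (Γ.ray d u) ≠ 0} :=
    nhdsWithin_le_nhds (hfin.isClosed.isOpen_compl.mem_nhds (by simp))
  obtain ⟨ρ, hρ, h⟩ := mem_nhdsGT_iff_exists_Ioo_subset.1 h1
  refine ⟨min ρ d.length, lt_min hρ d.length_pos, min_le_right _ _, fun u hu => ?_⟩
  by_contra hne
  exact h ⟨hu.1, hu.2.trans_le (min_le_left _ _)⟩
    ⟨⟨hu.1, hu.2.trans_le (min_le_right _ _)⟩, hne⟩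

/-! ### The maximum principle for reduced divisors -/

theorem compactSpace [Finite V] [Finite E] : CompactSpace Γ.Point := by
  refine ⟨?_⟩
  have h : (univ : Set Γ.Point) =
      range Point.vertex ∪ ⋃ e, Γ.edgePt e '' Icc 0 (Γ.len e) := by
    refine (eq_univ_of_forall fun x => ?_).symm
    cases x with
    | vertex v => exact Or.inl ⟨v, rfl⟩
    | inner e t h0 h1 =>
      exact Or.inr (mem_iUnion.2 ⟨e, t, ⟨h0.le, h1.le⟩, edgePt_of_mem e ⟨h0, h1⟩⟩)
  rw [h]
  exact (finite_range _).isCompact.union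
    (isCompact_iUnion fun e => isCompact_Icc.image (continuous_edgePt e))

open scoped Classical in
theorem outDeg_eq_card [Finite E] (X : Set Γ.Point) (v : Γ.Point) :
    Γ.outDeg X v = ((dirs v).filter fun d => ∃ ε > 0, ∀ s ∈ Ioc 0 ε, Γ.ray d s ∉ X).card := by
  rw [outDeg, ← Set.ncard_coe_finset]
  congr 1
  ext d
  simp

/-- If `D` is `P`-reduced and `D + div f` is effective away from `P`, then `f` is maximal at `P`:
otherwise a connected component of the maximum locus of `f` violates the reducedness of `D`. -/
theorem IsReduced.le_apply [Finite V] [Finite E] {P : Γ.Point} {D : Γ.Divisor}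
    (hD : Γ.IsReduced P D) {f : Γ.Point → ℝ} (hf : Γ.IsRational f)
    (heff : ∀ v, v ≠ P → (0 : ℝ) ≤ D v + Γ.ord f v) (x : Γ.Point) : f x ≤ f P := by
  classical
  have := compactSpace (Γ := Γ)
  obtain ⟨x₀, -, hx₀⟩ := isCompact_univ.exists_isMaxOn ⟨P, mem_univ P⟩ hf.1.continuousOn
  replace hx₀ : ∀ x, f x ≤ f x₀ := fun x => hx₀ (mem_univ x)
  suffices f P = f x₀ from this ▸ hx₀ x
  let Z : Set Γ.Point := {x | f x = f x₀}
  have hZ : IsClosed Z := isClosed_eq hf.1 continuous_const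
  by_contra hP
  let X := connectedComponentIn Z x₀
  have hXZ : X ⊆ Z := connectedComponentIn_subset Z x₀
  have hXc : IsClosed X := by
    -- The closure of `X` is connected and contained in the closed set `Z`.
    refine isClosed_of_closure_subset ?_
    exact isPreconnected_connectedComponentIn.closure.subset_connectedComponentIn
      (subset_closure (mem_connectedComponentIn rfl)) (closure_minimal hXZ hZ)
  obtain ⟨v, hv, hlt⟩ := hD.2 X hXc (isConnected_connectedComponentIn_iff.2 rfl)
    fun hPX => hP (hXZ hPX)
  have hvX : v ∈ X := hXc.frontier_subset hv
  have hvZ : f v = f x₀ := hXZ hvX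
  have hmax : ∀ x, f x ≤ f v := fun x => hvZ ▸ hx₀ x
  have hvP : v ≠ P := fun h => hP (h ▸ hvZ)
  have hout : Γ.ord f v ≤ -(Γ.outDeg X v : ℝ) := by
    rw [ord_eq_sum, outDeg_eq_card, Finset.card_filter]
    push_cast
    rw [← Finset.sum_neg_distrib]
    refine Finset.sum_le_sum fun d hd => ?_
    have hb := mem_dirs.1 hd
    have hle := hf.slope_nonpos d (by rwa [hb])
    split_ifs with hX
    · obtain ⟨m, hm⟩ := hf.exists_slope d
      rcases hle.eq_or_lt with h0 | h0
      · exfalso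
        obtain ⟨ε, hε, hX⟩ := hX
        obtain ⟨δ, hδ, hg⟩ := hf.hasGerm d
        have hmin := lt_min hε hδ
        refine hX (min ε δ) ⟨hmin, min_le_left _ _⟩ ?_
        have hsub : Γ.ray d '' Icc 0 (min ε δ) ⊆ connectedComponentIn Z v := by
          refine (isPreconnected_Icc.image _ (continuous_ray d).continuousOn)
            |>.subset_connectedComponentIn ⟨0, ⟨le_rfl, hmin.le⟩, hb⟩ ?_
          rintro _ ⟨s, hs, rfl⟩
          have := hg s ⟨hs.1, hs.2.trans (min_le_right _ _)⟩
          rw [h0, hb, hvZ] at this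
          simpa [Z] using this
        have hXv : connectedComponentIn Z v = X := (connectedComponentIn_eq hvX).symm
        exact hXv ▸ hsub ⟨_, ⟨hmin.le, le_rfl⟩, rfl⟩
      · rw [hm] at h0 ⊢
        have : m < 0 := by exact_mod_cast h0
        exact_mod_cast (show m ≤ -1 by omega)
    · simpa using hle
  have h1 := heff v hvP
  have h2 : (D v : ℝ) < Γ.outDeg X v := by exact_mod_cast hlt
  linarith

/-! ### Principal divisors have degree zero -/

theorem exists_breakpoints {g : ℝ → ℝ} {L : ℝ} (h : IsPL g 0 L) (hL : 0 ≤ L) :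
    ∃ T : Finset ℝ, (∀ x ∈ T, x ∈ Ioo 0 L) ∧
      ∀ x ∈ Ioo 0 L, x ∉ T → lslope g x = rslope g x := by
  classical
  obtain ⟨n, t, m, h0, hn, ht, hg⟩ := h.exists_partition hL
  refine ⟨((Finset.range n).image t).filter fun x => x ∈ Ioo 0 L,
    fun x hx => (Finset.mem_filter.1 hx).2, fun x hx hxT => ?_⟩
  obtain ⟨i, hi, h1, h2⟩ := exists_index_le_lt (x := x) (t := t) (n := n) (by rw [h0]; exact hx.1.le)
    (by rw [hn]; exact hx.2)
  have h3 : t i < x := h1.lt_of_ne fun h => hxT (Finset.mem_filter.2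
    ⟨Finset.mem_image.2 ⟨i, Finset.mem_range.2 hi, h⟩, hx⟩)
  have hR : RGerm g x (m i) := ⟨t (i + 1) - x, by linarith, fun u hu => by
    rw [hg i hi (x + u) ⟨by linarith [hu.1], by linarith [hu.2]⟩, hg i hi x ⟨h1, h2.le⟩]; ring⟩
  have hL : LGerm g x (m i) := ⟨x - t i, by linarith, fun u hu => by
    rw [hg i hi (x - u) ⟨by linarith [hu.2], by linarith [hu.1]⟩, hg i hi x ⟨h1, h2.le⟩]; ring⟩
  rw [hR.rslope_eq, hL.lslope_eq]

/-- The orders of a rational function vanish outside a finite set and add up to zero. -/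
theorem IsRational.exists_finset_sum_ord [Finite V] [Finite E] {f : Γ.Point → ℝ}
    (hf : Γ.IsRational f) :
    ∃ S : Finset Γ.Point, (∀ P ∉ S, Γ.ord f P = 0) ∧ ∑ P ∈ S, Γ.ord f P = 0 := by
  classical
  have := Fintype.ofFinite V
  have := Fintype.ofFinite E
  have hpl : ∀ e, IsPL (fun s => f (Γ.edgePt e s)) 0 (Γ.len e) :=
    isPL_edge (isRational_iff.1 hf)
  choose T hT hTj using fun e => exists_breakpoints (hpl e) (Γ.len_pos e).le
  let d₀ : E → Γ.Dir := fun e => .fwd e 0 ⟨le_rfl, Γ.len_pos e⟩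
  let d₁ : E → Γ.Dir := fun e => .bwd e (Γ.len e) ⟨Γ.len_pos e, le_rfl⟩
  have hd₀ : ∀ e, d₀ e = Dir.fwd e 0 ⟨le_rfl, Γ.len_pos e⟩ := fun _ => rfl
  have hray : ∀ e s, Γ.ray (d₀ e) s = Γ.edgePt e s := fun e s => by simp [d₀, ray]
  have hlen : ∀ e, (d₀ e).length = Γ.len e := fun e => by simp [d₀, Dir.length]
  have hord : ∀ e, ∀ s ∈ Ioo 0 (Γ.len e), Γ.ord f (Γ.edgePt e s) =
      rslope (fun s => f (Γ.edgePt e s)) s - lslope (fun s => f (Γ.edgePt e s)) s := fun e s hs => by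
    have := ord_ray_eq_jump f (d₀ e) (s := s) (by rwa [hlen])
    simpa only [hray] using this
  let SV : Finset Γ.Point := Finset.univ.image Point.vertex
  let SE : Finset Γ.Point := Finset.univ.biUnion fun e => (T e).image (Γ.edgePt e)
  have hdisj : Disjoint SV SE := by
    rw [Finset.disjoint_left]
    intro x hx hx'
    obtain ⟨v, -, rfl⟩ := Finset.mem_image.1 hx
    obtain ⟨e, -, he⟩ := Finset.mem_biUnion.1 hx'
    obtain ⟨s, hs, he⟩ := Finset.mem_image.1 he
    exact edgePt_ne_vertex (hT e s hs) v he
  refine ⟨SV ∪ SE, fun P hP => ?_, ?_⟩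
  · cases P with
    | vertex v => exact absurd (Finset.mem_union_left SE (by simp [SV])) hP
    | inner e t h0 h1 =>
      have ht : t ∉ T e := fun ht => hP <| Finset.mem_union_right SV <| Finset.mem_biUnion.2
        ⟨e, Finset.mem_univ e, Finset.mem_image.2 ⟨t, ht, edgePt_of_mem e ⟨h0, h1⟩⟩⟩
      rw [← edgePt_of_mem e ⟨h0, h1⟩, hord e t ⟨h0, h1⟩, hTj e t ⟨h0, h1⟩ ht, sub_self]
  have hE : ∑ P ∈ SE, Γ.ord f P = ∑ e, (-Γ.slope f (d₁ e) - Γ.slope f (d₀ e)) := by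
    rw [Finset.sum_biUnion fun e _ e' _ hne => ?_]
    · refine Finset.sum_congr rfl fun e _ => ?_
      rw [Finset.sum_image fun s hs t ht h => (eq_of_edgePt_eq (hT e t ht) h).2,
        Finset.sum_congr rfl fun s hs => hord e s (hT e s hs),
        (hpl e).sum_jump (Γ.len_pos e) (T e) (hT e) (hTj e)]
      simp [slope, lslope, rslope, ray, d₀, d₁]
    · rw [Function.onFun, Finset.disjoint_left]
      intro x hx hx'
      obtain ⟨s, hs, rfl⟩ := Finset.mem_image.1 hx
      obtain ⟨t, ht, h⟩ := Finset.mem_image.1 hx'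
      exact hne (eq_of_edgePt_eq (hT e s hs) h).1.symm
  have hV : ∑ P ∈ SV, Γ.ord f P = ∑ e, (Γ.slope f (d₀ e) + Γ.slope f (d₁ e)) := by
    let A : Finset Γ.Dir := Finset.univ.image d₀ ∪ Finset.univ.image d₁
    have hb₀ : ∀ e, Γ.base (d₀ e) = .vertex (Γ.src e) := fun e => by
      rw [base, hray, edgePt_zero]
    have hb₁ : ∀ e, Γ.base (d₁ e) = .vertex (Γ.tgt e) := fun e => by
      simp [base, d₁, ray, edgePt_len]
    have hmaps : ∀ d ∈ A, Γ.base d ∈ SV := by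
      intro d hd
      rcases Finset.mem_union.1 hd with hd | hd <;> obtain ⟨e, -, rfl⟩ := Finset.mem_image.1 hd
      · simp [hb₀, SV]
      · simp [hb₁, SV]
    have hA : ∑ d ∈ A, Γ.slope f d = ∑ e, (Γ.slope f (d₀ e) + Γ.slope f (d₁ e)) := by
      rw [Finset.sum_union, Finset.sum_image, Finset.sum_image, Finset.sum_add_distrib]
      · intro e _ e' _ h; simpa [d₁] using (Dir.bwd.inj h).1
      · intro e _ e' _ h; simpa [d₀] using (Dir.fwd.inj h).1
      · rw [Finset.disjoint_left]
        intro d hd hd'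
        obtain ⟨e, -, rfl⟩ := Finset.mem_image.1 hd
        obtain ⟨e', -, h⟩ := Finset.mem_image.1 hd'
        simp [d₀, d₁] at h
    rw [← hA, ← Finset.sum_fiberwise_of_maps_to hmaps]
    refine Finset.sum_congr rfl fun P hP => ?_
    rw [ord_eq_sum]
    refine Finset.sum_congr ?_ fun _ _ => rfl
    obtain ⟨v, -, rfl⟩ := Finset.mem_image.1 hP
    ext d
    rw [mem_dirs, Finset.mem_filter]
    refine ⟨fun hd => ⟨?_, hd⟩, fun hd => hd.2⟩
    cases d with
    | fwd e x hx =>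
      rcases hx.1.eq_or_lt with rfl | h
      · exact Finset.mem_union_left _ (Finset.mem_image_of_mem d₀ (Finset.mem_univ e))
      · simp only [base, ray, add_zero] at hd
        exact absurd hd (edgePt_ne_vertex ⟨h, hx.2⟩ v)
    | bwd e x hx =>
      rcases hx.2.eq_or_lt with rfl | h
      · exact Finset.mem_union_right _ (Finset.mem_image_of_mem d₁ (Finset.mem_univ e))
      · simp only [base, ray, sub_zero] at hd
        exact absurd hd (edgePt_ne_vertex ⟨hx.1, h⟩ v)
  rw [Finset.sum_union hdisj, hE, hV, ← Finset.sum_add_distrib]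
  exact Finset.sum_eq_zero fun e _ => by ring

theorem deg_add (D D' : Γ.Divisor) : Γ.deg (D + D') = Γ.deg D + Γ.deg D' :=
  Finsupp.sum_add_index' (fun _ => rfl) fun _ _ _ => rfl

theorem deg_single (P : Γ.Point) (n : ℤ) : Γ.deg (Finsupp.single P n) = n :=
  Finsupp.sum_single_index rfl

theorem apply_le_deg {D : Γ.Divisor} (hD : 0 ≤ D) (P : Γ.Point) : D P ≤ Γ.deg D := by
  by_cases hP : P ∈ D.support
  · exact Finset.single_le_sum (f := fun x => D x) (fun x _ => hD x) hP
  · rw [Finsupp.notMem_support_iff.1 hP]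
    exact Finset.sum_nonneg fun x _ => hD x

/-- The divisor of a rational function: its coefficients are the orders, and its degree is zero. -/
theorem IsRational.exists_divisor [Finite V] [Finite E] {f : Γ.Point → ℝ} (hf : Γ.IsRational f) :
    ∃ D : Γ.Divisor, (∀ P, (D P : ℝ) = Γ.ord f P) ∧ Γ.deg D = 0 := by
  classical
  obtain ⟨S, hS, hsum⟩ := hf.exists_finset_sum_ord
  choose m hm using hf.exists_ord
  refine ⟨Finsupp.onFinset S m fun P hP => ?_, fun P => (hm P).symm, ?_⟩
  · by_contra h
    exact hP (by exact_mod_cast (hm P).symm.trans (hS P h))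
  · rw [deg, Finsupp.onFinset_sum _ fun _ => rfl]
    exact_mod_cast (Finset.sum_congr rfl fun P _ => (hm P).symm).trans hsum

theorem LinEquiv.deg_eq [Finite V] [Finite E] {D D' : Γ.Divisor} (h : Γ.LinEquiv D D') :
    Γ.deg D = Γ.deg D' := by
  obtain ⟨f, hf, h⟩ := h
  obtain ⟨F, hF, hdeg⟩ := hf.exists_divisor
  have : D = D' + F := by
    ext P
    have := h P
    rw [← hF] at this
    exact_mod_cast this
  rw [this, deg_add, hdeg, add_zero]

/-! ### Bounded slopes and the largest rational function of a linear system -/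

/-- A property that spreads along rays holds everywhere once it holds at one point. -/
theorem point_induction {p : Γ.Point → Prop} {P : Γ.Point} (hP : p P)
    (h : ∀ d : Γ.Dir, ∀ s ∈ Ioc 0 d.length, p (Γ.base d) → p (Γ.ray d s)) (x : Γ.Point) : p x := by
  have h' : ∀ d : Γ.Dir, ∀ s ∈ Ioc 0 d.length, p (Γ.base d) ↔ p (Γ.ray d s) := fun d s hs =>
    ⟨h d s hs, fun hp => by
      have := h (d.rev s hs) s ⟨hs.1, d.le_length_rev hs⟩ (by rwa [base_rev])
      rwa [ray_rev, sub_self] at this⟩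
  have hedge : ∀ e, ∀ t ∈ Ioc 0 (Γ.len e), p (.vertex (Γ.src e)) ↔ p (Γ.edgePt e t) := fun e t ht => by
    have := h' (.fwd e 0 ⟨le_rfl, Γ.len_pos e⟩) t (by simpa [Dir.length] using ht)
    simpa [base, ray, edgePt_zero] using this
  have hvert : ∀ u v, p (.vertex u) ↔ p (.vertex v) := fun u v => by
    have := Γ.connected u v
    induction this with
    | rel x y hxy =>
      obtain ⟨e, rfl, rfl⟩ := hxy
      rw [hedge e _ ⟨Γ.len_pos e, le_rfl⟩, edgePt_len]
    | refl x => rfl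
    | symm x y _ ih => exact ih.symm
    | trans x y z _ _ ih ih' => exact ih.trans ih'
  have hall : ∀ x, ∃ v, p x ↔ p (.vertex v) := fun x => by
    cases x with
    | vertex v => exact ⟨v, Iff.rfl⟩
    | inner e t h0 h1 =>
      exact ⟨Γ.src e, by rw [hedge e t ⟨h0, h1.le⟩, edgePt_of_mem e ⟨h0, h1⟩]⟩
  obtain ⟨v, hv⟩ := hall P
  obtain ⟨w, hw⟩ := hall x
  exact hw.2 ((hvert v w).1 (hv.1 hP))

theorem affine_max_of_lt {k : ℝ → ℝ} {m c : ℝ} (h : ∃ ε > 0, ∀ u ∈ Icc 0 ε, k u = k 0 + m * u)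
    (hc : c < k 0) : ∃ ε > 0, ∀ u ∈ Icc 0 ε, max (k u) c = max (k 0) c + m * u := by
  obtain ⟨ε, hε, h⟩ := h
  have h1 : ∀ᶠ u in 𝓝[>] (0 : ℝ), c < k 0 + m * u := by
    have : Tendsto (fun u => k 0 + m * u) (𝓝 0) (𝓝 (k 0 + m * 0)) :=
      (by fun_prop : Continuous fun u => k 0 + m * u).tendsto 0
    exact nhdsWithin_le_nhds (this.eventually_const_lt (by simpa using hc))
  obtain ⟨δ, hδ, h1⟩ := mem_nhdsGT_iff_exists_Ioo_subset.1 h1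
  refine ⟨min ε (δ / 2), lt_min hε (half_pos hδ), fun u hu => ?_⟩
  rw [h u ⟨hu.1, hu.2.trans (min_le_left _ _)⟩, max_eq_left hc.le]
  rcases hu.1.eq_or_lt with rfl | h0
  · simpa using hc.le
  · exact max_eq_left (h1 ⟨h0, by
      linarith [hu.2.trans (min_le_right _ _), show (0 : ℝ) < δ from hδ]⟩).le

theorem affine_max_of_eq {k : ℝ → ℝ} {m c : ℝ} (h : ∃ ε > 0, ∀ u ∈ Icc 0 ε, k u = k 0 + m * u)
    (hc : k 0 = c) : ∃ ε > 0, ∀ u ∈ Icc 0 ε, max (k u) c = max (k 0) c + max m 0 * u := by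
  obtain ⟨ε, hε, h⟩ := h
  refine ⟨ε, hε, fun u hu => ?_⟩
  rw [h u hu, hc, max_self]
  rcases le_total m 0 with hm | hm
  · rw [max_eq_right hm, max_eq_right] <;> nlinarith [hu.1]
  · rw [max_eq_left hm, max_eq_left]; nlinarith [hu.1]

theorem affine_max_of_gt {k : ℝ → ℝ} {m c : ℝ} (h : ∃ ε > 0, ∀ u ∈ Icc 0 ε, k u = k 0 + m * u)
    (hc : k 0 < c) : ∃ ε > 0, ∀ u ∈ Icc 0 ε, max (k u) c = max (k 0) c + 0 * u := by
  obtain ⟨ε, hε, h⟩ := h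
  have h1 : ∀ᶠ u in 𝓝[>] (0 : ℝ), k 0 + m * u < c := by
    have : Tendsto (fun u => k 0 + m * u) (𝓝 0) (𝓝 (k 0 + m * 0)) :=
      (by fun_prop : Continuous fun u => k 0 + m * u).tendsto 0
    exact nhdsWithin_le_nhds (this.eventually_lt_const (by simpa using hc))
  obtain ⟨δ, hδ, h1⟩ := mem_nhdsGT_iff_exists_Ioo_subset.1 h1
  refine ⟨min ε (δ / 2), lt_min hε (half_pos hδ), fun u hu => ?_⟩
  rw [h u ⟨hu.1, hu.2.trans (min_le_left _ _)⟩, max_eq_right hc.le]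
  rcases hu.1.eq_or_lt with rfl | h0
  · simpa using hc.le
  · simpa using (h1 ⟨h0, by
      linarith [hu.2.trans (min_le_right _ _), show (0 : ℝ) < δ from hδ]⟩).le

theorem affine_max {k : ℝ → ℝ} {c : ℝ} (h : ∃ m : ℤ, ∃ ε > 0, ∀ u ∈ Icc 0 ε, k u = k 0 + m * u) :
    ∃ m : ℤ, ∃ ε > 0, ∀ u ∈ Icc 0 ε, max (k u) c = max (k 0) c + m * u := by
  obtain ⟨m, h⟩ := h
  rcases lt_trichotomy (k 0) c with hc | hc | hc
  · exact ⟨0, by simpa using affine_max_of_gt h hc⟩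
  · exact ⟨max m 0, by simpa using affine_max_of_eq h hc⟩
  · exact ⟨m, affine_max_of_lt h hc⟩

theorem IsRational.max_const {f : Γ.Point → ℝ} (hf : Γ.IsRational f) (c : ℝ) :
    Γ.IsRational fun x => max (f x) c :=
  isRational_iff.2 fun d => affine_max (k := fun u => f (Γ.ray d u)) (isRational_iff.1 hf d)

/-- If `D` and `D + div f` are effective, no slope of `f` drops below `-deg D`: truncating `f` from
below just after the base point of a direction of slope `-m` yields a rational function whose
divisor has coefficient `m` at the cut, while `D` bounds its negative coefficients. -/
theorem neg_deg_le_slope [Finite V] [Finite E] {D : Γ.Divisor} (hD : 0 ≤ D) {f : Γ.Point → ℝ}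
    (hf : Γ.IsRational f) (heff : ∀ P, (0 : ℝ) ≤ D P + Γ.ord f P) (d : Γ.Dir) :
    -(Γ.deg D : ℝ) ≤ Γ.slope f d := by
  have hdeg : 0 ≤ Γ.deg D := (hD (Γ.base d)).trans (apply_le_deg hD _)
  by_cases hm0 : 0 ≤ Γ.slope f d
  · have : (0 : ℝ) ≤ Γ.deg D := by exact_mod_cast hdeg
    linarith
  have hlen := d.length_pos
  obtain ⟨ε, hε, -, hg⟩ := ((hf.isPL d).rgerm ⟨le_rfl, hlen⟩).nearby
  obtain ⟨s, hs0, hs⟩ := exists_between (lt_min hε hlen)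
  have hsl : s ∈ Ioo 0 d.length := ⟨hs0, hs.trans_le (min_le_right _ _)⟩
  obtain ⟨hR, hL⟩ := hg s ⟨hs0, hs.trans_le (min_le_left _ _)⟩
  rw [zero_add] at hR hL
  rw [← slope_eq_rslope] at hR hL
  set m := Γ.slope f d with hm
  set c := f (Γ.ray d s) with hc
  have hG := hf.max_const c
  obtain ⟨F, hF, hFdeg⟩ := hG.exists_divisor
  have hmin : ∀ P, f P ≤ c → ∀ x, max (f P) c ≤ max (f x) c := fun P hP x => by
    rw [max_eq_right hP]; exact le_max_right _ _
  have heffG : 0 ≤ D + F := by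
    intro P
    have : (0 : ℝ) ≤ D P + Γ.ord (fun x => max (f x) c) P := by
      rcases lt_or_ge c (f P) with hP | hP
      · refine (heff P).trans_eq ?_
        rw [ord_eq_sum, ord_eq_sum]
        congr 1
        refine Finset.sum_congr rfl fun e he => ?_
        have := affine_max_of_lt (k := fun u => f (Γ.ray e u)) (hf.hasGerm e)
          (by rw [ray_zero, mem_dirs.1 he]; exact hP)
        exact (HasGerm.slope_eq (f := fun x => max (f x) c) this).symm
      · have h1 := hG.ord_nonneg (hmin P hP)
        have h2 : (0 : ℝ) ≤ D P := by exact_mod_cast hD P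
        linarith
    rw [← hF] at this
    exact_mod_cast this
  have h1 := apply_le_deg heffG (Γ.ray d s)
  rw [deg_add, hFdeg, add_zero, Finsupp.add_apply] at h1
  have h2 : (-m : ℝ) ≤ F (Γ.ray d s) := by
    rw [hF, ord_ray _ d hsl]
    have hadv := hG.slope_nonneg (d.adv s (Ioo_subset_Ico_self hsl)) (by
      rw [base_adv]; exact hmin _ hc.ge)
    have hrev : Γ.slope (fun x => max (f x) c) (d.rev s (Ioo_subset_Ioc_self hsl)) = max (-m) 0 := by
      refine HasGerm.slope_eq (affine_max_of_eq (k := fun u => f (Γ.ray _ u)) ?_ ?_)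
      · have := hf.hasGerm (d.rev s (Ioo_subset_Ioc_self hsl))
        rwa [slope_rev, hL.lslope_eq] at this
      · rw [ray_rev, sub_zero]
    rw [hrev]
    linarith [le_max_left (-m) 0]
  have h3 : (0 : ℝ) ≤ D (Γ.ray d s) := by exact_mod_cast hD _
  have h4 : (D (Γ.ray d s) : ℝ) + F (Γ.ray d s) ≤ Γ.deg D := by exact_mod_cast h1
  linarith

/-- The rational functions `f` with `D + div f` effective that vanish at `P`. -/
def sectionsAt (D : Γ.Divisor) (P : Γ.Point) : Set (Γ.Point → ℝ) :=
  {f | Γ.IsRational f ∧ (∀ Q, (0 : ℝ) ≤ D Q + Γ.ord f Q) ∧ f P = 0}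

theorem exists_pos_forall_le {ι : Type*} (s : Finset ι) {c : ι → ℝ} (hc : ∀ i ∈ s, 0 < c i) :
    ∃ η > 0, ∀ i ∈ s, η ≤ c i := by
  have : ∀ᶠ η in 𝓝[>] (0 : ℝ), ∀ i ∈ s, η ≤ c i := by
    rw [Filter.eventually_all_finset]
    intro i hi
    filter_upwards [Ioc_mem_nhdsGT (hc i hi)] with η hη using hη.2
  obtain ⟨η, h1, h2⟩ := (this.and self_mem_nhdsWithin).exists
  exact ⟨η, h2, h1⟩

/-- Where `D` vanishes on a ray, every `f` with `D + div f` effective is convex. -/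
theorem jump_nonneg [Finite E] {D : Γ.Divisor} {f : Γ.Point → ℝ}
    (heff : ∀ P, (0 : ℝ) ≤ D P + Γ.ord f P) {d : Γ.Dir} {ρ : ℝ}
    (hρ : ρ ≤ d.length) (hfree : ∀ u ∈ Ioo 0 ρ, D (Γ.ray d u) = 0) {u : ℝ} (hu : u ∈ Ioo 0 ρ) :
    lslope (fun s => f (Γ.ray d s)) u ≤ rslope (fun s => f (Γ.ray d s)) u := by
  have h1 := heff (Γ.ray d u)
  rw [hfree u hu, ord_ray_eq_jump f d ⟨hu.1, hu.2.trans_le hρ⟩] at h1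
  simpa using h1

section Sections

variable [Finite V] [Finite E] {D : Γ.Divisor} {f : Γ.Point → ℝ}

theorem ray_lower_bound (hD : 0 ≤ D) (hf : Γ.IsRational f)
    (heff : ∀ P, (0 : ℝ) ≤ D P + Γ.ord f P) (d : Γ.Dir) {u : ℝ} (hu : u ∈ Icc 0 d.length) :
    f (Γ.base d) - Γ.deg D * u ≤ f (Γ.ray d u) := by
  have := (hf.isPL d).le_of_le_rslope (m := -(Γ.deg D : ℝ)) (fun x hx => by
    rw [← slope_adv f d hx]; exact neg_deg_le_slope hD hf heff _) u hu
  rw [ray_zero] at this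
  linarith

theorem ray_upper_bound (hD : 0 ≤ D) (hf : Γ.IsRational f)
    (heff : ∀ P, (0 : ℝ) ≤ D P + Γ.ord f P) (d : Γ.Dir) {w v : ℝ} (hw : 0 ≤ w) (hwv : w ≤ v)
    (hv : v ≤ d.length) : f (Γ.ray d v) ≤ f (Γ.ray d w) + Γ.deg D * (v - w) := by
  rcases hwv.eq_or_lt with rfl | hlt
  · simp
  have hmem : v ∈ Ioc 0 d.length := ⟨hw.trans_lt hlt, hv⟩
  have := ray_lower_bound hD hf heff (d.rev v hmem) (u := v - w)
    ⟨by linarith, by linarith [d.le_length_rev hmem]⟩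
  rw [base_rev, ray_rev, sub_sub_cancel] at this
  linarith

theorem bddAbove_sections (hD : 0 ≤ D) (P x : Γ.Point) :
    BddAbove ((fun f : Γ.Point → ℝ => f x) '' sectionsAt D P) := by
  refine point_induction (p := fun x => BddAbove ((fun f => f x) '' sectionsAt D P)) (P := P)
    ⟨0, ?_⟩ (fun d s hs hb => ?_) x
  · rintro _ ⟨f, hf, rfl⟩
    exact hf.2.2.le
  · obtain ⟨C, hC⟩ := hb
    refine ⟨C + Γ.deg D * s, ?_⟩
    rintro _ ⟨f, hf, rfl⟩
    have h1 := ray_upper_bound hD hf.1 hf.2.1 d le_rfl hs.1.le hs.2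
    have h2 : f (Γ.base d) ≤ C := hC ⟨f, hf, rfl⟩
    rw [ray_zero] at h1
    simp only
    linarith

/-- The pointwise supremum of a family of functions with `D + div f` effective has a germ of integer
slope along every direction. The slope is the largest integer `m` such that `f₀(base) + m u` is, up
to an arbitrarily small error, a lower bound of members of the family along a stretch of fixed
length. -/
theorem exists_germ_sup (hD : 0 ≤ D) {P : Γ.Point} {f₀ : Γ.Point → ℝ}
    (hle : ∀ f ∈ sectionsAt D P, ∀ x, f x ≤ f₀ x)
    (happ : ∀ x, ∀ δ > 0, ∃ f ∈ sectionsAt D P, f₀ x - δ < f x) (d : Γ.Dir) :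
    ∃ m : ℤ, HasGerm f₀ d m := by
  obtain ⟨ρ, hρ, hρl, hfree⟩ := exists_free D d
  set K := Γ.deg D with hK
  let Q : ℤ → Prop := fun m => ∀ δ > 0, ∃ f ∈ sectionsAt D P, ∀ u ∈ Icc 0 ρ,
    f₀ (Γ.base d) - δ + m * u ≤ f (Γ.ray d u)
  have hQ : ∃ m, Q m := ⟨-K, fun δ hδ => by
    obtain ⟨f, hf, h⟩ := happ (Γ.base d) δ hδ
    refine ⟨f, hf, fun u hu => ?_⟩
    have := ray_lower_bound hD hf.1 hf.2.1 d (u := u) ⟨hu.1, hu.2.trans hρl⟩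
    push_cast
    linarith⟩
  have hQK : ∀ m, Q m → m ≤ K := fun m hm => by
    by_contra! hlt
    obtain ⟨f, hf, h⟩ := hm (ρ / 2) (half_pos hρ)
    have h1 := h ρ ⟨hρ.le, le_rfl⟩
    have h2 := ray_upper_bound hD hf.1 hf.2.1 d le_rfl hρ.le hρl
    have h3 := hle f hf (Γ.base d)
    have h4 : (K : ℝ) + 1 ≤ m := by exact_mod_cast hlt
    rw [ray_zero] at h2
    nlinarith
  obtain ⟨m, hm, hmax⟩ := Int.exists_greatest_of_bdd ⟨K, hQK⟩ hQ
  have hmK : (m : ℝ) ≤ K := by exact_mod_cast hQK m hm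
  have hnQ : ¬ Q (m + 1) := fun h => by have := hmax _ h; omega
  simp only [Q, not_forall] at hnQ
  obtain ⟨δ, hδ, hnQ⟩ := hnQ
  push Not at hnQ
  refine ⟨m, min (ρ / 2) (δ / (K - m + 1)), lt_min (half_pos hρ) (div_pos hδ (by linarith)),
    fun v hv => le_antisymm ?_ ?_⟩
  · refine le_of_forall_pos_le_add fun τ hτ => ?_
    obtain ⟨f, hf, hfv⟩ := happ (Γ.ray d v) τ hτ
    suffices f (Γ.ray d v) ≤ f₀ (Γ.base d) + m * v by linarith
    by_contra! hlt
    have hvρ : v ≤ ρ / 2 := hv.2.trans (min_le_left _ _)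
    have hvδ : v * (K - m + 1) ≤ δ :=
      (le_div_iff₀ (by linarith)).1 (hv.2.trans (min_le_right _ _))
    have hpl := (hf.1.isPL d).mono le_rfl hρl
    have hconv := fun u hu => jump_nonneg hf.2.1 hρl hfree (u := u) hu
    -- Some slope on `[0, v)` exceeds `m`, so by convexity all slopes beyond `v` do.
    obtain ⟨x, hx, hxm⟩ : ∃ x ∈ Ico 0 v, (m : ℝ) < rslope (fun s => f (Γ.ray d s)) x := by
      by_contra! hcon
      have := (hpl.mono le_rfl (by linarith : v ≤ ρ)).le_of_rslope_le hcon v ⟨hv.1, le_rfl⟩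
      simp only [ray_zero, sub_zero] at this
      linarith [hle f hf (Γ.base d)]
    have hxρ : x ∈ Ico 0 ρ := ⟨hx.1, by linarith [hx.2]⟩
    have hxm1 : (m : ℝ) + 1 ≤ rslope (fun s => f (Γ.ray d s)) x := by
      obtain ⟨k, hk⟩ := hpl.exists_rslope hxρ
      rw [hk] at hxm ⊢
      exact_mod_cast hxm
    have hmono := ((hpl.mono hxρ.1 le_rfl).rslope_mono fun y hy =>
      hconv y ⟨hxρ.1.trans_lt hy.1, hy.2⟩).1
    obtain ⟨w, hw, hwlt⟩ := hnQ f hf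
    push_cast at hwlt
    rcases le_total v w with hvw | hwv
    · have := (hpl.mono hv.1 le_rfl).le_of_le_rslope (m := m + 1)
        (fun y hy => hxm1.trans (hmono y ⟨hx.2.le.trans hy.1, hy.2⟩)) w ⟨hvw, hw.2⟩
      have : v ≤ δ := by nlinarith [hv.1]
      nlinarith
    · have := ray_upper_bound hD hf.1 hf.2.1 d hw.1 hwv (by linarith)
      have h1 : 0 ≤ (K - m : ℝ) * w := mul_nonneg (by linarith) hw.1
      nlinarith
  · refine le_of_forall_pos_le_add fun τ hτ => ?_
    obtain ⟨f, hf, h⟩ := hm τ hτ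
    have h1 := h v ⟨hv.1, by linarith [hv.2.trans (min_le_left _ _)]⟩
    have h2 := hle f hf (Γ.ray d v)
    linarith

/-- Among the rational functions that vanish at `P` and keep `D` effective, one is largest. -/
theorem exists_greatest_section (hD : 0 ≤ D) (P : Γ.Point) :
    ∃ f₀ ∈ sectionsAt D P, ∀ f ∈ sectionsAt D P, ∀ x, f x ≤ f₀ x := by
  have hne : (sectionsAt D P).Nonempty := by
    refine ⟨fun _ => 0, isRational_const 0, fun Q => ?_, rfl⟩
    rw [ord_const, add_zero]
    exact_mod_cast hD Q
  let f₀ : Γ.Point → ℝ := fun x => sSup ((fun f : Γ.Point → ℝ => f x) '' sectionsAt D P)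
  have hle : ∀ f ∈ sectionsAt D P, ∀ x, f x ≤ f₀ x := fun f hf x =>
    le_csSup (bddAbove_sections hD P x) ⟨f, hf, rfl⟩
  have happ : ∀ x, ∀ δ > 0, ∃ f ∈ sectionsAt D P, f₀ x - δ < f x := fun x δ hδ => by
    obtain ⟨_, ⟨f, hf, rfl⟩, h⟩ := exists_lt_of_lt_csSup (hne.image fun f : Γ.Point → ℝ => f x)
      (show f₀ x - δ < f₀ x by linarith)
    exact ⟨f, hf, h⟩
  have hrat : Γ.IsRational f₀ := isRational_iff.2 (exists_germ_sup hD hle happ)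
  refine ⟨f₀, ⟨hrat, fun Q => ?_, ?_⟩, hle⟩
  · choose ε hε hgerm using hrat.hasGerm
    choose ρ hρ hρl hfree using exists_free D
    obtain ⟨η, hη, hηle⟩ := exists_pos_forall_le (dirs Q) (c := fun d => min (ε d) (ρ d))
      fun d _ => lt_min (hε d) (hρ d)
    -- A member of the family that is `η`-close to `f₀` at `Q` has no larger slopes there.
    obtain ⟨f, hf, hfQ⟩ := happ Q η hη
    refine (hf.2.1 Q).trans (add_le_add_right ?_ _)
    rw [ord_eq_sum, ord_eq_sum]
    refine Finset.sum_le_sum fun d hd => ?_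
    have hb := mem_dirs.1 hd
    have hη1 := (hηle d hd).trans (min_le_left _ _)
    have hη2 := (hηle d hd).trans (min_le_right _ _)
    obtain ⟨k, hk⟩ := hf.1.exists_slope d
    obtain ⟨m, hm⟩ := hrat.exists_slope d
    rw [hk, hm]
    by_contra! hlt
    have hlt' : (m : ℝ) + 1 ≤ k := by exact_mod_cast hlt
    have h1 := ((hf.1.isPL d).mono le_rfl (hρl d)).tangent_le
      (fun u hu => jump_nonneg hf.2.1 (hρl d) (hfree d) hu) η ⟨hη.le, hη2⟩
    have h2 := hgerm d η ⟨hη.le, hη1⟩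
    have h3 := hle f hf (Γ.ray d η)
    rw [← slope_eq_rslope, hk] at h1
    simp only [ray_zero, hb] at h1
    rw [hm, hb] at h2
    nlinarith
  · have : (fun f : Γ.Point → ℝ => f P) '' sectionsAt D P = {0} := by
      refine Subset.antisymm ?_ ?_
      · rintro _ ⟨f, hf, rfl⟩
        exact hf.2.2
      · rintro _ rfl
        obtain ⟨f, hf⟩ := hne
        exact ⟨f, hf, hf.2.2⟩
    simp only [f₀, this, csSup_singleton]

end Sections

/-! ### Existence of reduced divisors -/

theorem Dir.exists_param (d : Γ.Dir) : ∃ (e : E) (t σ : ℝ), (σ = 1 ∨ σ = -1) ∧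
    (∀ u, Γ.ray d u = Γ.edgePt e (t + σ * u)) ∧
    ∀ u ∈ Icc 0 d.length, t + σ * u ∈ Icc 0 (Γ.len e) := by
  cases d with
  | fwd e t ht =>
    refine ⟨e, t, 1, Or.inl rfl, fun u => by simp [ray], fun u hu => ?_⟩
    have : u ≤ Γ.len e - t := hu.2
    exact ⟨by linarith [ht.1, hu.1], by linarith⟩
  | bwd e t ht =>
    refine ⟨e, t, -1, Or.inr rfl, fun u => by simp [ray, sub_eq_add_neg], fun u hu => ?_⟩
    have : u ≤ t := hu.2
    exact ⟨by linarith, by linarith [ht.2, hu.1]⟩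

section Firing

variable (X : Set Γ.Point)

/-- The parameters in `[0, len e]` of the points of `X` on the edge `e`. -/
def edgeTrace (e : E) : Set ℝ := {t | t ∈ Icc 0 (Γ.len e) ∧ Γ.edgePt e t ∈ X}

open scoped Classical in
/-- The firing height on an edge: `ε` on `X`, decreasing with slope `1` away from `X` down to `0`.
An edge that misses `X` is treated apart because `Metric.infDist t ∅ = 0`. -/
noncomputable def edgeHeight (ε : ℝ) (e : E) (t : ℝ) : ℝ :=
  if (edgeTrace X e).Nonempty then max (ε - Metric.infDist t (edgeTrace X e)) 0 else 0

open scoped Classical in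
/-- The function that fires the set `X`: `ε` on `X`, decreasing with slope `1` away from `X`. It
vanishes at the vertices outside `X`, which is consistent with the heights along the edges as soon as
`ε` is small. -/
noncomputable def height (ε : ℝ) : Γ.Point → ℝ
  | .vertex v => if .vertex v ∈ X then ε else 0
  | .inner e t _ _ => edgeHeight X ε e t

variable {X}

theorem isClosed_edgeTrace (hX : IsClosed X) (e : E) : IsClosed (edgeTrace X e) :=
  isClosed_Icc.inter (hX.preimage (continuous_edgePt e))

theorem edgeHeight_of_mem {ε : ℝ} (hε : 0 < ε) {e : E} {t : ℝ} (ht : t ∈ edgeTrace X e) :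
    edgeHeight X ε e t = ε := by
  rw [edgeHeight, if_pos ⟨t, ht⟩, Metric.infDist_zero_of_mem ht, sub_zero, max_eq_left hε.le]

theorem edgeHeight_nonneg (ε : ℝ) (e : E) (t : ℝ) : 0 ≤ edgeHeight X ε e t := by
  rw [edgeHeight]
  split_ifs
  exacts [le_max_right _ _, le_rfl]

theorem height_nonneg {ε : ℝ} (hε : 0 < ε) (x : Γ.Point) : 0 ≤ height X ε x := by
  cases x with
  | vertex v =>
    rw [height]
    split_ifs
    exacts [hε.le, le_rfl]
  | inner e t h0 h1 => exact edgeHeight_nonneg ε e t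

theorem height_of_mem {ε : ℝ} (hε : 0 < ε) {x : Γ.Point} (hx : x ∈ X) : height X ε x = ε := by
  cases x with
  | vertex v => exact if_pos hx
  | inner e t h0 h1 =>
    exact edgeHeight_of_mem hε ⟨⟨h0.le, h1.le⟩, by rwa [edgePt_of_mem e ⟨h0, h1⟩]⟩

theorem height_lt_of_notMem (hX : IsClosed X) {ε : ℝ} (hε : 0 < ε) {x : Γ.Point} (hx : x ∉ X) :
    height X ε x < ε := by
  cases x with
  | vertex v => rwa [height, if_neg hx]
  | inner e t h0 h1 =>
    rw [height, edgeHeight]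
    split_ifs with hne
    · refine max_lt ?_ hε
      have := ((isClosed_edgeTrace hX e).notMem_iff_infDist_pos hne (x := t)).1 fun ht => hx (by
        rw [← edgePt_of_mem e ⟨h0, h1⟩]; exact ht.2)
      linarith
    · exact hε

/-- For small `ε`, the values at the vertices match the heights along all edges: a vertex outside `X`
has distance at least `ε` from `X` along every edge. -/
theorem exists_small_height [Finite E] (hX : IsClosed X) : ∃ ε > 0, ∀ (e : E),
    ∀ t ∈ Icc 0 (Γ.len e), height X ε (Γ.edgePt e t) = edgeHeight X ε e t := by
  classical
  have := Fintype.ofFinite E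
  let c : E × Bool → ℝ := fun p =>
    let t := if p.2 then 0 else Γ.len p.1
    if 0 < Metric.infDist t (edgeTrace X p.1) then Metric.infDist t (edgeTrace X p.1) else 1
  obtain ⟨ε, hε, hle⟩ := exists_pos_forall_le Finset.univ (c := c) fun p _ => by
    simp only [c]
    split_ifs with h1 h2
    all_goals first | assumption | exact one_pos
  have hend : ∀ e t, t ∈ Icc 0 (Γ.len e) → (t = 0 ∨ t = Γ.len e) → ∀ v, Γ.edgePt e t = .vertex v →
      height X ε (.vertex v) = edgeHeight X ε e t := fun e t ht hor v hv => by
    by_cases hvX : Point.vertex v ∈ X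
    · rw [height_of_mem hε hvX, edgeHeight_of_mem hε ⟨ht, by rwa [hv]⟩]
    · rw [height, if_neg hvX, edgeHeight]
      split_ifs with hne
      · have hpos := ((isClosed_edgeTrace hX e).notMem_iff_infDist_pos hne (x := t)).1
          fun h => hvX (hv ▸ h.2)
        rw [max_eq_right]
        rcases hor with rfl | rfl
        · have := hle (e, true) (Finset.mem_univ _)
          simp only [c, if_true, if_pos hpos] at this
          linarith
        · have := hle (e, false) (Finset.mem_univ _)
          simp only [c, Bool.false_eq_true, if_false, if_pos hpos] at this
          linarith
      · rfl
  refine ⟨ε, hε, fun e t ht => ?_⟩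
  rcases ht.1.eq_or_lt with rfl | h0
  · rw [edgePt_zero]
    exact hend e 0 ht (Or.inl rfl) _ (edgePt_zero e)
  · rcases ht.2.eq_or_lt with rfl | h1
    · rw [edgePt_len]
      exact hend e _ ht (Or.inr rfl) _ (edgePt_len e)
    · rw [edgePt_of_mem e ⟨h0, h1⟩, height]

variable {ε : ℝ}

theorem hasGerm_height_of_leaving (hε : 0 < ε) (hedge : ∀ (e : E),
    ∀ t ∈ Icc 0 (Γ.len e), height X ε (Γ.edgePt e t) = edgeHeight X ε e t) (d : Γ.Dir)
    (hb : Γ.base d ∈ X) (hout : ∃ δ > 0, ∀ s ∈ Ioc 0 δ, Γ.ray d s ∉ X) :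
    HasGerm (height X ε) d (-1) := by
  obtain ⟨e, t, σ, hσ, hray, hmem⟩ := d.exists_param
  obtain ⟨δ, hδ, hout⟩ := hout
  have ht0 := hmem 0 ⟨le_rfl, d.length_pos.le⟩
  have hb0 : Γ.base d = Γ.edgePt e t := by rw [← ray_zero, hray]; simp
  rw [mul_zero, add_zero] at ht0
  have ht : t ∈ edgeTrace X e := ⟨ht0, hb0 ▸ hb⟩
  refine ⟨min (min (δ / 2) ε) d.length, lt_min (lt_min (half_pos hδ) hε) d.length_pos,
    fun u hu => ?_⟩
  have h1 : u ≤ δ / 2 := hu.2.trans ((min_le_left _ _).trans (min_le_left _ _))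
  have h2 : u ≤ ε := hu.2.trans ((min_le_left _ _).trans (min_le_right _ _))
  rw [height_of_mem hε hb, hray, hedge _ _ (hmem u ⟨hu.1, hu.2.trans (min_le_right _ _)⟩),
    edgeHeight, if_pos ⟨t, ht⟩, infDist_of_mem hσ ht (δ := δ) (fun w hw hwC => hout w hw (by
      rw [hray]; exact hwC.2)) ⟨hu.1, h1⟩, max_eq_left (by linarith)]
  ring

/-- If the points at which a direction leaves `X` lie in the support of a divisor, then a direction
based in `X` that does not leave `X` starts with a stretch inside `X`. -/
theorem exists_stretch_in (hX : IsClosed X) {D : Γ.Divisor}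
    (hD : ∀ d : Γ.Dir, Γ.base d ∈ X → (∃ δ > 0, ∀ s ∈ Ioc 0 δ, Γ.ray d s ∉ X) → D (Γ.base d) ≠ 0)
    (d : Γ.Dir) (hstay : ¬ ∃ δ > 0, ∀ s ∈ Ioc 0 δ, Γ.ray d s ∉ X) :
    ∃ δ > 0, ∀ s ∈ Ioc 0 δ, Γ.ray d s ∈ X := by
  obtain ⟨ρ, hρ, hρl, hfree⟩ := exists_free D d
  by_contra! hcon
  obtain ⟨u, hu, huX⟩ := hcon (ρ / 2) (half_pos hρ)
  push Not at hstay
  obtain ⟨v, hv, hvX⟩ := hstay u hu.1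
  -- `w` is the last parameter before `u` at which the ray meets `X`.
  have hS : IsCompact (Icc v u ∩ Γ.ray d ⁻¹' X) :=
    isCompact_Icc.inter_right (hX.preimage (continuous_ray d))
  obtain ⟨w, ⟨hw, hwX⟩, hmax⟩ := hS.exists_isGreatest ⟨v, ⟨le_rfl, hv.2⟩, hvX⟩
  have hwu : w < u := hw.2.lt_of_ne fun h => huX (h ▸ hwX)
  have hw0 : 0 < w := hv.1.trans_le hw.1
  have hwl : w ∈ Ico 0 d.length := ⟨hw0.le, by linarith [hu.2]⟩
  refine hD (d.adv w hwl) (by rwa [base_adv]) ⟨u - w, sub_pos.2 hwu, fun s hs hsX => ?_⟩ ?_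
  · rw [ray_adv] at hsX
    have := hmax ⟨⟨by linarith [hs.1, hw.1], by linarith [hs.2]⟩, hsX⟩
    linarith [hs.1]
  · rw [base_adv]
    exact hfree w ⟨hw0, by linarith [hu.2]⟩

theorem hasGerm_height_of_staying (hε : 0 < ε) (d : Γ.Dir) (hb : Γ.base d ∈ X)
    (h : ∃ δ > 0, ∀ s ∈ Ioc 0 δ, Γ.ray d s ∈ X) : HasGerm (height X ε) d 0 := by
  obtain ⟨δ, hδ, h⟩ := h
  refine ⟨δ, hδ, fun s hs => ?_⟩
  rcases hs.1.eq_or_lt with rfl | h0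
  · simp [ray_zero]
  · rw [height_of_mem hε hb, height_of_mem hε (h s ⟨h0, hs.2⟩), zero_mul, add_zero]

theorem exists_germ_height_of_notMem (hX : IsClosed X) (hedge : ∀ (e : E),
    ∀ t ∈ Icc 0 (Γ.len e), height X ε (Γ.edgePt e t) = edgeHeight X ε e t) (d : Γ.Dir)
    (hb : Γ.base d ∉ X) : ∃ m : ℤ, HasGerm (height X ε) d m := by
  obtain ⟨e, t, σ, hσ, hray, hmem⟩ := d.exists_param
  have hb0 : Γ.base d = Γ.edgePt e t := by rw [← ray_zero, hray]; simp
  suffices h : ∃ m : ℤ, ∃ δ > 0, ∀ u ∈ Icc 0 δ,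
      edgeHeight X ε e (t + σ * u) = edgeHeight X ε e (t + σ * 0) + m * u by
    obtain ⟨m, δ, hδ, h⟩ := h
    refine ⟨m, min δ d.length, lt_min hδ d.length_pos, fun u hu => ?_⟩
    rw [← ray_zero, hray, hray, hedge _ _ (hmem u ⟨hu.1, hu.2.trans (min_le_right _ _)⟩),
      hedge _ _ (hmem 0 ⟨le_rfl, d.length_pos.le⟩), h u ⟨hu.1, hu.2.trans (min_le_left _ _)⟩]
  by_cases hne : (edgeTrace X e).Nonempty
  · simp only [edgeHeight, if_pos hne]
    refine affine_max (k := fun u => ε - Metric.infDist (t + σ * u) (edgeTrace X e)) ?_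
    obtain ⟨m, k, -, ⟨δ, hδ, hR⟩, δ', hδ', hL⟩ := exists_germs_infDist (isClosed_edgeTrace hX e) hne
      (t := t) fun ht => hb (hb0 ▸ ht.2)
    rcases hσ with rfl | rfl
    · refine ⟨-m, δ, hδ, fun u hu => ?_⟩
      simp only [hR u hu, mul_zero, add_zero]
      push_cast
      ring
    · refine ⟨-k, δ', hδ', fun u hu => ?_⟩
      simp only [hL u hu, mul_zero, add_zero]
      push_cast
      ring
  · exact ⟨0, 1, one_pos, fun u _ => by simp [edgeHeight, hne]⟩

/-- Outside `X` the firing function has no negative orders: it is minimal at the vertices, and on an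
edge it is the maximum of `0` and a function without concave kinks. -/
theorem ord_height_nonneg [Finite E] (hX : IsClosed X) (hε : 0 < ε) (hedge : ∀ (e : E),
    ∀ t ∈ Icc 0 (Γ.len e), height X ε (Γ.edgePt e t) = edgeHeight X ε e t)
    (hrat : Γ.IsRational (height X ε)) {x : Γ.Point} (hx : x ∉ X) : 0 ≤ Γ.ord (height X ε) x := by
  by_cases hz : height X ε x = 0
  · exact hrat.ord_nonneg fun y => hz ▸ height_nonneg hε y
  have hpos : 0 < height X ε x := (height_nonneg hε x).lt_of_ne' hz
  cases x with
  | vertex v => exact absurd (if_neg hx) hz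
  | inner e t h0 h1 =>
    have hne : (edgeTrace X e).Nonempty := by
      by_contra hne
      exact hpos.ne' (if_neg hne)
    have htC : t ∉ edgeTrace X e := fun ht => hx (by
      rw [← edgePt_of_mem e ⟨h0, h1⟩]; exact ht.2)
    have hpos' : 0 < ε - Metric.infDist t (edgeTrace X e) := by
      by_contra! hle
      exact hpos.ne' ((if_pos hne).trans (max_eq_right hle))
    obtain ⟨m, k, hmk, ⟨δ, hδ, hR⟩, δ', hδ', hL⟩ :=
      exists_germs_infDist (isClosed_edgeTrace hX e) hne htC
    let d : Γ.Dir := .fwd e 0 ⟨le_rfl, Γ.len_pos e⟩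
    have hray : ∀ s, Γ.ray d s = Γ.edgePt e s := fun s => by simp [d, ray]
    have hloc : ∀ s ∈ Icc 0 (Γ.len e), height X ε (Γ.ray d s) =
        max (ε - Metric.infDist s (edgeTrace X e)) 0 := fun s hs => by
      rw [hray, hedge e s hs, edgeHeight, if_pos hne]
    have ht : t ∈ Icc 0 (Γ.len e) := ⟨h0.le, h1.le⟩
    obtain ⟨ε₁, hε₁, hR'⟩ := affine_max_of_lt (c := 0) (m := -(m : ℝ))
      (k := fun u => ε - Metric.infDist (t + 1 * u) (edgeTrace X e))
      ⟨δ, hδ, fun u hu => by simp only [hR u hu, mul_zero, add_zero]; ring⟩ (by simpa using hpos')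
    obtain ⟨ε₂, hε₂, hL'⟩ := affine_max_of_lt (c := 0) (m := -(k : ℝ))
      (k := fun u => ε - Metric.infDist (t + -1 * u) (edgeTrace X e))
      ⟨δ', hδ', fun u hu => by simp only [hL u hu, mul_zero, add_zero]; ring⟩ (by simpa using hpos')
    have hRG : RGerm (fun s => height X ε (Γ.ray d s)) t (-m) :=
      ⟨min ε₁ (Γ.len e - t), lt_min hε₁ (sub_pos.2 h1), fun u hu => by
        have h2 := hu.2.trans (min_le_right _ _)
        have := hR' u ⟨hu.1, hu.2.trans (min_le_left _ _)⟩
        simp only [one_mul, mul_zero, add_zero] at this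
        simp only
        rw [hloc _ ⟨by linarith [hu.1], by linarith⟩, hloc t ht, this]⟩
    have hLG : LGerm (fun s => height X ε (Γ.ray d s)) t k :=
      ⟨min ε₂ t, lt_min hε₂ h0, fun u hu => by
        have h2 := hu.2.trans (min_le_right _ _)
        have := hL' u ⟨hu.1, hu.2.trans (min_le_left _ _)⟩
        simp only [neg_mul, one_mul, mul_zero, add_zero, ← sub_eq_add_neg] at this
        simp only
        rw [hloc _ ⟨by linarith, by linarith [hu.1]⟩, hloc t ht, this]⟩
    have hxray : Point.inner e t h0 h1 = Γ.ray d t := by rw [hray, edgePt_of_mem e ⟨h0, h1⟩]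
    rw [hxray, ord_ray_eq_jump _ d (by simpa [d, Dir.length] using And.intro h0 h1),
      hRG.rslope_eq, hLG.lslope_eq]
    have : (m : ℝ) + k ≤ 0 := by exact_mod_cast hmk
    linarith

end Firing

/-- An effective divisor is linearly equivalent to a `P`-reduced effective one: its coefficients are
moved by the largest rational function, normalized at `P`, that keeps it effective. Were a closed set
saturated, firing it a little would give a larger function. -/
theorem exists_isReduced [Finite V] [Finite E] {D : Γ.Divisor} (hD : 0 ≤ D) (P : Γ.Point) :
    ∃ D' : Γ.Divisor, Γ.IsReduced P D' ∧ Γ.LinEquiv D' D := by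
  classical
  obtain ⟨f₀, ⟨hf, heff, hP⟩, hmax⟩ := exists_greatest_section hD P
  obtain ⟨F, hF, -⟩ := hf.exists_divisor
  have hcoef : ∀ Q, ((D + F) Q : ℝ) = D Q + Γ.ord f₀ Q := fun Q => by
    rw [Finsupp.add_apply, Int.cast_add, hF]
  have hpos : 0 ≤ D + F := fun Q => by
    have := heff Q
    rw [← hcoef] at this
    exact_mod_cast this
  refine ⟨D + F, ⟨fun v _ => hpos v, fun X hX hXc hPX => ?_⟩, f₀, hf, hcoef⟩
  by_contra! hsat
  have hout : ∀ d : Γ.Dir, Γ.base d ∈ X → (∃ δ > 0, ∀ s ∈ Ioc 0 δ, Γ.ray d s ∉ X) →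
      Γ.base d ∈ frontier X := fun d hb ⟨δ, hδ, h⟩ => by
    rw [hX.frontier_eq]
    refine ⟨hb, fun hint => ?_⟩
    have h1 : ∀ᶠ s in 𝓝[>] (0 : ℝ), Γ.ray d s ∈ X :=
      nhdsWithin_le_nhds ((continuous_ray d).tendsto 0 (mem_interior_iff_mem_nhds.1 hint))
    obtain ⟨s, hs, hs'⟩ := (h1.and (Ioc_mem_nhdsGT hδ)).exists
    exact h s hs' hs
  have hchip : ∀ d : Γ.Dir, Γ.base d ∈ X → (∃ δ > 0, ∀ s ∈ Ioc 0 δ, Γ.ray d s ∉ X) →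
      (D + F) (Γ.base d) ≠ 0 := fun d hb h => by
    have h1 := hsat _ (hout d hb h)
    rw [outDeg_eq_card] at h1
    have h2 : 0 < ((dirs (Γ.base d)).filter fun d => ∃ ε > 0, ∀ s ∈ Ioc 0 ε, Γ.ray d s ∉ X).card :=
      Finset.card_pos.2 ⟨d, by simpa using h⟩
    omega
  obtain ⟨ε, hε, hedge⟩ := exists_small_height hX
  have hstay : ∀ d : Γ.Dir, Γ.base d ∈ X → (¬ ∃ δ > 0, ∀ s ∈ Ioc 0 δ, Γ.ray d s ∉ X) →
      HasGerm (height X ε) d 0 := fun d hb h =>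
    hasGerm_height_of_staying hε d hb (exists_stretch_in hX hchip d h)
  have hrat : Γ.IsRational (height X ε) := by
    refine isRational_iff.2 fun d => ?_
    by_cases hb : Γ.base d ∈ X
    · by_cases h : ∃ δ > 0, ∀ s ∈ Ioc 0 δ, Γ.ray d s ∉ X
      · exact ⟨-1, by simpa using hasGerm_height_of_leaving hε hedge d hb h⟩
      · exact ⟨0, by simpa using hstay d hb h⟩
    · exact exists_germ_height_of_notMem hX hedge d hb
  have heff' : ∀ Q, (0 : ℝ) ≤ (D + F) Q + Γ.ord (height X ε) Q := fun Q => by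
    have hQ0 : (0 : ℝ) ≤ (D + F) Q := by exact_mod_cast hpos Q
    by_cases hQ : Q ∈ X
    · have hord : Γ.ord (height X ε) Q = -(Γ.outDeg X Q : ℝ) := by
        rw [ord_eq_sum, outDeg_eq_card, Finset.card_filter]
        push_cast
        rw [← Finset.sum_neg_distrib]
        refine Finset.sum_congr rfl fun d hd => ?_
        have hb : Γ.base d ∈ X := by rwa [mem_dirs.1 hd]
        split_ifs with h
        · exact (hasGerm_height_of_leaving hε hedge d hb h).slope_eq
        · rw [(hstay d hb h).slope_eq, neg_zero]
      rw [hord]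
      by_cases h0 : Γ.outDeg X Q = 0
      · simpa [h0] using hQ0
      · rw [outDeg_eq_card] at h0
        obtain ⟨d, hd⟩ := Finset.card_pos.1 (Nat.pos_of_ne_zero h0)
        rw [Finset.mem_filter, mem_dirs] at hd
        have h1 := hsat Q (hd.1 ▸ hout d (by rwa [hd.1]) hd.2)
        have h2 : (Γ.outDeg X Q : ℝ) ≤ (D + F) Q := by exact_mod_cast h1
        linarith
    · exact add_nonneg hQ0 (ord_height_nonneg hX hε hedge hrat hQ)
  obtain ⟨x, hx⟩ := hXc.nonempty
  have h1 := hmax (fun y => f₀ y + (height X ε y + -height X ε P)) ⟨hf.add (hrat.add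
    (isRational_const _)), fun Q => by
      rw [hf.ord_add (hrat.add (isRational_const _)), hrat.ord_add (isRational_const _), ord_const,
        add_zero, ← add_assoc, ← hcoef]
      exact heff' Q, by simp only [hP]; ring⟩ x
  rw [height_of_mem hε hx] at h1
  linarith [height_lt_of_notMem hX hε hPX]

/-! ### Families of reduced divisors of constant coefficient -/

/-- At a maximum of nonnegative order all slopes vanish. -/
theorem IsRational.slope_eq_zero [Finite E] {f : Γ.Point → ℝ} (hf : Γ.IsRational f) {P : Γ.Point}
    (hmax : ∀ x, f x ≤ f P) (hord : 0 ≤ Γ.ord f P) {d : Γ.Dir} (hd : Γ.base d = P) :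
    Γ.slope f d = 0 := by
  rw [ord_eq_sum] at hord
  have hle : ∀ d ∈ dirs P, Γ.slope f d ≤ 0 := fun d hd =>
    hf.slope_nonpos d (by rwa [mem_dirs.1 hd])
  exact (Finset.sum_eq_zero_iff_of_nonpos hle).1 (le_antisymm (Finset.sum_nonpos hle) hord) d
    (mem_dirs.2 hd)

/-- A maximum persists along a ray on which the function is convex and does not start downward. -/
theorem IsRational.eq_max_on_ray [Finite E] {f : Γ.Point → ℝ} (hf : Γ.IsRational f) {M : ℝ}
    (hM : ∀ x, f x ≤ M) {d : Γ.Dir} (hd : f (Γ.base d) = M) (hslope : 0 ≤ Γ.slope f d) {s : ℝ}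
    (hs : s ≤ d.length) (hord : ∀ u ∈ Ioo 0 s, 0 ≤ Γ.ord f (Γ.ray d u)) {u : ℝ}
    (hu : u ∈ Icc 0 s) : f (Γ.ray d u) = M := by
  have h1 := ((hf.isPL d).mono le_rfl hs).tangent_le (fun x hx => by
    have := hord x hx
    rw [ord_ray_eq_jump f d ⟨hx.1, hx.2.trans_le hs⟩] at this
    linarith) u hu
  rw [← slope_eq_rslope] at h1
  simp only [ray_zero, hd, sub_zero] at h1
  exact le_antisymm (hM _) (by nlinarith [hu.1])

/-- A choice of a reduced divisor for every base point, all in one linear equivalence class, whose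
coefficient at the base point is the constant `a`. -/
structure IsReducedFamily (F : Γ.Point → Γ.Divisor) (a : ℤ) : Prop where
  isReduced : ∀ P, Γ.IsReduced P (F P)
  linEquiv : ∀ P Q, Γ.LinEquiv (F P) (F Q)
  apply_self : ∀ P, F P P = a

namespace IsReducedFamily

variable {F : Γ.Point → Γ.Divisor} {a : ℤ}

theorem nonneg (hF : IsReducedFamily F a) (ha : 1 ≤ a) (P x : Γ.Point) : 0 ≤ F P x := by
  by_cases h : x = P
  · rw [h, hF.apply_self]; omega
  · exact (hF.isReduced P).1 x h

/-- The function that transfers the base point from `P` to `Q` is maximal at `P` and minimal at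
`Q`. -/
theorem exists_transfer [Finite V] [Finite E] (hF : IsReducedFamily F a) (ha : 1 ≤ a) (P Q : Γ.Point) :
    ∃ f : Γ.Point → ℝ, Γ.IsRational f ∧ (∀ x, (F Q x : ℝ) = F P x + Γ.ord f x) ∧
      (∀ x, f x ≤ f P) ∧ ∀ x, f Q ≤ f x := by
  obtain ⟨f, hf, h⟩ := hF.linEquiv Q P
  refine ⟨f, hf, h, (hF.isReduced P).le_apply hf fun x _ => ?_, fun x => ?_⟩
  · rw [← h]
    exact_mod_cast hF.nonneg ha Q x
  · have := (hF.isReduced Q).le_apply hf.neg (fun x _ => by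
      rw [hf.ord_neg, h, add_neg_cancel_right]
      exact_mod_cast hF.nonneg ha P x) x
    exact neg_le_neg_iff.1 this

/-- When the base point slides from `P` a little along a direction to `Q`, the divisors differ by a
function `f` that falls with slope `-a` from `P` to `Q`, and is locally constant beyond both: on a
stretch of the ray without chips `f` is convex, so it drops by at most `a` times the distance of `P`
and `Q`. This is too little for `f` to rise again, with an integer slope, to the right of its minimum
`Q`; as its slope increases by `a` at `Q`, it is `-a` before. -/
theorem exists_slide [Finite E] (hF : IsReducedFamily F a) (ha : 1 ≤ a) (d : Γ.Dir) :
    ∃ ε > 0, ε ≤ d.length ∧ (∀ u ∈ Ioo 0 ε, F (Γ.base d) (Γ.ray d u) = 0) ∧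
      ∀ s ∈ Ioo 0 ε, ∀ f : Γ.Point → ℝ, Γ.IsRational f →
        (∀ x, (F (Γ.ray d s) x : ℝ) = F (Γ.base d) x + Γ.ord f x) →
        (∀ x, f x ≤ f (Γ.base d)) → (∀ x, f (Γ.ray d s) ≤ f x) →
        (∀ d', Γ.base d' = Γ.base d → d' ≠ d → Γ.slope f d' = 0) ∧ Γ.slope f d = -a ∧
        F (Γ.ray d s) (Γ.base d) = 0 ∧ (∀ u ∈ Ioo 0 s, F (Γ.ray d s) (Γ.ray d u) = 0) ∧
        ∀ hs : s ∈ Ico 0 d.length, Γ.slope f (d.adv s hs) = 0 := by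
  classical
  obtain ⟨ρ, hρ, hρl, hfree⟩ := exists_free (F (Γ.base d)) d
  have ha' : (1 : ℝ) ≤ a := by exact_mod_cast ha
  have hερ : ρ / (a + 2) ≤ ρ := div_le_self hρ.le (by linarith)
  refine ⟨ρ / (a + 2), div_pos hρ (by linarith), hερ.trans hρl,
    fun u hu => hfree u ⟨hu.1, hu.2.trans_le hερ⟩, fun s hs f hf hfs hmax hmin => ?_⟩
  have hsmall : s * (a + 2) < ρ := (lt_div_iff₀ (by linarith)).1 hs.2
  have hsρ : s < ρ := hs.2.trans_le hερ
  have hs0 := hs.1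
  have hsl : s ∈ Ico 0 d.length := ⟨hs0.le, hsρ.trans_le hρl⟩
  set g : ℝ → ℝ := fun u => f (Γ.ray d u) with hg
  set Q := Γ.ray d s with hQ
  have hpl : IsPL g 0 ρ := (hf.isPL d).mono le_rfl hρl
  have hjump : ∀ u ∈ Ioo 0 ρ, (F Q (Γ.ray d u) : ℝ) = rslope g u - lslope g u := fun u hu => by
    rw [hfs, hfree u hu, ord_ray_eq_jump f d ⟨hu.1, hu.2.trans_le hρl⟩, Int.cast_zero, zero_add]
  have hconv : ∀ u ∈ Ioo 0 ρ, lslope g u ≤ rslope g u := fun u hu => by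
    have h1 := hjump u hu
    have h2 : (0 : ℝ) ≤ F Q (Γ.ray d u) := by exact_mod_cast hF.nonneg ha Q _
    linarith
  have hg0 : g 0 = f (Γ.base d) := rfl
  have hle : ∀ d' ∈ dirs (Γ.base d), Γ.slope f d' ≤ 0 := fun d' hd' =>
    hf.slope_nonpos d' (by rwa [mem_dirs.1 hd'])
  have hsum : Γ.slope f d + ∑ d' ∈ (dirs (Γ.base d)).erase d, Γ.slope f d' =
      F Q (Γ.base d) - a := by
    rw [Finset.add_sum_erase _ _ (mem_dirs.2 rfl), ← ord_eq_sum, hfs, hF.apply_self]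
    ring
  have hrest : ∑ d' ∈ (dirs (Γ.base d)).erase d, Γ.slope f d' ≤ 0 :=
    Finset.sum_nonpos fun d' hd' => hle d' (Finset.mem_of_mem_erase hd')
  have hFP : (0 : ℝ) ≤ F Q (Γ.base d) := by exact_mod_cast hF.nonneg ha Q _
  have hσ : -(a : ℝ) ≤ rslope g 0 := by
    rw [← slope_eq_rslope]
    linarith
  have hgs : g 0 - a * s ≤ g s := by
    have := hpl.tangent_le hconv s ⟨hs0.le, hsρ.le⟩
    nlinarith
  have hr0 : 0 ≤ rslope g s := by
    have := hf.slope_nonneg (d.adv s hsl) (by rwa [base_adv])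
    rwa [slope_adv] at this
  have hr : rslope g s = 0 := by
    by_contra hne
    obtain ⟨k, hk⟩ := hpl.exists_rslope ⟨hs0.le, hsρ⟩
    have hk1 : (1 : ℝ) ≤ rslope g s := by
      have hpos := hr0.lt_of_ne' hne
      rw [hk] at hpos ⊢
      exact_mod_cast hpos
    have h1 := (hpl.mono hs0.le le_rfl).tangent_le
      (fun u hu => hconv u ⟨hs0.trans hu.1, hu.2⟩) ρ ⟨hsρ.le, le_rfl⟩
    have h2 : g ρ ≤ g 0 := hmax _
    nlinarith
  have hl : lslope g s = -a := by
    have := hjump s ⟨hs0, hsρ⟩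
    rw [← hQ, hF.apply_self, hr] at this
    linarith
  have hmono := (hpl.mono le_rfl hsρ.le).rslope_mono fun u hu => hconv u ⟨hu.1, hu.2.trans hsρ⟩
  have hσ' : Γ.slope f d = -a := by
    have := hmono.2 s ⟨hs0, le_rfl⟩
    rw [slope_eq_rslope]
    exact le_antisymm (this.trans_eq hl) hσ
  have hFP0 : (F Q (Γ.base d) : ℝ) = 0 := by linarith
  refine ⟨fun d' hd' hne => ?_, hσ', by exact_mod_cast hFP0, fun u hu => ?_, fun hs' => ?_⟩
  · exact (Finset.sum_eq_zero_iff_of_nonpos fun d' hd' => hle d' (Finset.mem_of_mem_erase hd')).1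
      (by linarith) d' (Finset.mem_erase.2 ⟨hne, mem_dirs.2 hd'⟩)
  · have h1 := hjump u ⟨hu.1, hu.2.trans hsρ⟩
    have h2 := hmono.2 u ⟨hu.1, hu.2.le⟩
    have h3 := ((hpl.mono hu.1.le hsρ.le).rslope_mono
      fun w hw => hconv w ⟨hu.1.trans hw.1, hw.2.trans hsρ⟩).2 s ⟨hu.2, le_rfl⟩
    rw [← slope_eq_rslope, hσ'] at h2
    have h4 : (F Q (Γ.ray d u) : ℝ) ≤ 0 := by linarith
    exact le_antisymm (by exact_mod_cast h4) (hF.nonneg ha Q _)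
  · rwa [slope_adv]

end IsReducedFamily

/-! ### Arcs -/

/-- `Arc v P K`: the set `K` is the trace of a simple path from `P` to `v`, that is, of a chain of
segments of rays each of which meets the later ones only in its end point. -/
inductive Arc (v : Γ.Point) : Γ.Point → Set Γ.Point → Prop
  | nil : Arc v v {v}
  | cons (d : Γ.Dir) (s : ℝ) (hs : s ∈ Ioc 0 d.length) {K : Set Γ.Point}
      (hK : Arc v (Γ.ray d s) K) (hdisj : ∀ u ∈ Ico 0 s, Γ.ray d u ∉ K) :
      Arc v (Γ.base d) (Γ.ray d '' Icc 0 s ∪ K)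

namespace Arc

variable {v P : Γ.Point} {K : Set Γ.Point}

theorem left_mem (h : Arc v P K) : P ∈ K := by
  cases h with
  | nil => exact mem_singleton v
  | cons d s hs hK hdisj => exact Or.inl ⟨0, ⟨le_rfl, hs.1.le⟩, rfl⟩

theorem right_mem (h : Arc v P K) : v ∈ K := by
  induction h with
  | nil => exact mem_singleton v
  | cons d s hs hK hdisj ih => exact Or.inr ih

/-- The part of an arc that remains after moving along its first segment. -/
theorem tail {d : Γ.Dir} {s : ℝ} (hs : s ∈ Ioc 0 d.length) (hK : Arc v (Γ.ray d s) K)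
    (hdisj : ∀ u ∈ Ico 0 s, Γ.ray d u ∉ K) {u : ℝ} (hu : u ∈ Icc 0 s) :
    Arc v (Γ.ray d u) (Γ.ray d '' Icc u s ∪ K) := by
  rcases hu.2.eq_or_lt with rfl | hlt
  · rwa [Icc_self, image_singleton, singleton_union, insert_eq_of_mem hK.left_mem]
  · have hul : u ∈ Ico 0 d.length := ⟨hu.1, hlt.trans_le hs.2⟩
    have h := Arc.cons (v := v) (K := K) (d.adv u hul) (s - u)
      ⟨sub_pos.2 hlt, by rw [Dir.length_adv]; linarith [hs.2]⟩
      (by rwa [ray_adv, add_sub_cancel])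
      fun w hw => by rw [ray_adv]; exact hdisj _ ⟨by linarith [hu.1, hw.1], by linarith [hw.2]⟩
    have himg : Γ.ray (d.adv u hul) '' Icc 0 (s - u) = Γ.ray d '' Icc u s := by
      have h1 : Γ.ray (d.adv u hul) = Γ.ray d ∘ fun w => u + w := funext fun w => ray_adv d hul w
      rw [h1, image_comp, image_const_add_Icc, add_zero, add_sub_cancel]
    rwa [base_adv, himg] at h

/-- The points just before the start of the remaining part are not on it. -/
theorem ray_notMem_tail {d : Γ.Dir} {s : ℝ} (hs : s ∈ Ioc 0 d.length)
    (hdisj : ∀ u ∈ Ico 0 s, Γ.ray d u ∉ K) {w u : ℝ} (hw : 0 < w) (hwu : w < u) (hus : u ≤ s) :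
    Γ.ray d w ∉ Γ.ray d '' Icc u s ∪ K := by
  rintro (⟨y, hy, h⟩ | h)
  · have := ray_injOn d (s := w) (t := y) ⟨hw, by linarith [hs.2]⟩
      ⟨by linarith [hy.1], hy.2.trans hs.2⟩ h
    linarith [hy.1]
  · exact hdisj w ⟨hw.le, by linarith⟩ h

theorem exists_subarc (h : Arc v P K) {x : Γ.Point} (hx : x ∈ K) : ∃ K' ⊆ K, Arc v x K' := by
  induction h with
  | nil => exact ⟨{v}, Subset.rfl, by rw [mem_singleton_iff.1 hx]; exact .nil⟩
  | @cons d s hs K hK hdisj ih =>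
    rcases hx with ⟨u, hu, rfl⟩ | hx
    · exact ⟨_, union_subset_union_left _ (image_mono (Icc_subset_Icc_left hu.1)),
        tail hs hK hdisj hu⟩
    · obtain ⟨K', hK', h'⟩ := ih hx
      exact ⟨K', hK'.trans subset_union_right, h'⟩

end Arc

theorem isClosed_iff_edges {K : Set Γ.Point} :
    IsClosed K ↔ ∀ e, IsClosed (Γ.edgePt e ⁻¹' K) :=
  ⟨fun h e => h.preimage (continuous_edgePt e), fun h => isClosed_iSup_iff.2 fun e =>
    isClosed_coinduced.2 (h e)⟩

theorem isClosed_edgePt_image (e : E) {α β : ℝ} : IsClosed (Γ.edgePt e '' Icc α β) := by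
  classical
  refine isClosed_iff_edges.2 fun e' => ?_
  set A := Γ.edgePt e' ⁻¹' (Γ.edgePt e '' Icc α β) with hA
  have hA' : A = ((if (0 : ℝ) ∈ A then Iic 0 else ∅) ∪
      (if Γ.len e' ∈ A then Ici (Γ.len e') else ∅)) ∪ (if e' = e then Icc α β else ∅) := by
    ext t
    have h0 : t ≤ 0 → (t ∈ A ↔ (0 : ℝ) ∈ A) := fun h => by
      rw [hA, mem_preimage, mem_preimage, edgePt_of_nonpos e' h, edgePt_zero]
    have h1 : Γ.len e' ≤ t → (t ∈ A ↔ Γ.len e' ∈ A) := fun h => by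
      rw [hA, mem_preimage, mem_preimage, edgePt_of_len_le e' h, edgePt_len]
    constructor
    · intro ht
      by_cases ht0 : t ≤ 0
      · exact Or.inl (Or.inl (by rw [if_pos ((h0 ht0).1 ht)]; exact ht0))
      by_cases ht1 : Γ.len e' ≤ t
      · exact Or.inl (Or.inr (by rw [if_pos ((h1 ht1).1 ht)]; exact ht1))
      obtain ⟨s, hs, hst⟩ := ht
      obtain ⟨rfl, rfl⟩ := eq_of_edgePt_eq ⟨not_le.1 ht0, not_le.1 ht1⟩ hst
      exact Or.inr (by rwa [if_pos rfl])
    · rintro ((ht | ht) | ht) <;> split_ifs at ht with h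
      · exact (h0 ht).2 h
      · exact ht.elim
      · exact (h1 ht).2 h
      · exact ht.elim
      · subst h; exact ⟨t, ht, rfl⟩
      · exact ht.elim
  rw [hA']
  refine (IsClosed.union ?_ ?_).union ?_ <;> split_ifs
  exacts [isClosed_Iic, isClosed_empty, isClosed_Ici, isClosed_empty, isClosed_Icc, isClosed_empty]

theorem isClosed_ray_image (d : Γ.Dir) (s : ℝ) : IsClosed (Γ.ray d '' Icc 0 s) := by
  cases d with
  | fwd e t ht =>
    have : Γ.ray (.fwd e t ht) = Γ.edgePt e ∘ fun s => t + s := rfl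
    rw [this, image_comp, image_const_add_Icc]
    exact isClosed_edgePt_image e
  | bwd e t ht =>
    have : Γ.ray (.bwd e t ht) = Γ.edgePt e ∘ fun s => t - s := rfl
    rw [this, image_comp, image_const_sub_Icc]
    exact isClosed_edgePt_image e

theorem Arc.isClosed {v P : Γ.Point} {K : Set Γ.Point} (h : Arc v P K) : IsClosed K := by
  induction h with
  | nil =>
    by_cases h : ∃ e t, Γ.edgePt e t = v
    · obtain ⟨e, t, rfl⟩ := h
      have := isClosed_edgePt_image (Γ := Γ) e (α := t) (β := t)
      rwa [Icc_self, image_singleton] at this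
    · push Not at h
      refine isClosed_iff_edges.2 fun e => ?_
      rw [(eq_empty_iff_forall_notMem.2 fun t => h e t : Γ.edgePt e ⁻¹' {v} = ∅)]
      exact isClosed_empty
  | cons d s hs hK hdisj ih => exact (isClosed_ray_image d s).union ih

/-- Any two points are joined by an arc: a segment leading to the start of an arc is cut at its first
point on the arc. -/
theorem exists_arc (v P : Γ.Point) : ∃ K, Arc v P K := by
  refine point_induction (p := fun P => ∃ K, Arc v P K) ⟨_, .nil⟩ (fun d s hs hK => ?_) P
  obtain ⟨K, hK⟩ := hK
  set d' := d.rev s hs with hd'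
  have hs' : s ≤ d'.length := d.le_length_rev hs
  have hend : Γ.ray d' s = Γ.base d := by rw [ray_rev, sub_self, ray_zero]
  have hS : IsCompact (Icc 0 s ∩ Γ.ray d' ⁻¹' K) :=
    isCompact_Icc.inter_right (hK.isClosed.preimage (continuous_ray d'))
  obtain ⟨w, ⟨hw, hwK⟩, hmin⟩ := hS.exists_isLeast
    ⟨s, ⟨hs.1.le, le_rfl⟩, by rw [mem_preimage, hend]; exact hK.left_mem⟩
  obtain ⟨K', hK', harc⟩ := hK.exists_subarc hwK
  have hb : Γ.base d' = Γ.ray d s := base_rev d hs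
  rcases hw.1.eq_or_lt with rfl | h0
  · rw [ray_zero, hb] at harc
    exact ⟨K', harc⟩
  · have := Arc.cons d' w ⟨h0, hw.2.trans hs'⟩ harc fun u hu huK =>
      absurd (hmin ⟨⟨hu.1, hu.2.le.trans hw.2⟩, hK' huK⟩) (not_le.2 hu.2)
    rw [hb] at this
    exact ⟨_, this⟩

/-- The maximum locus of `f` contains every arc that starts in it, provided that `f` does not go down
along the first step of the arc and has nonnegative orders on the rest of it. -/
theorem Arc.eq_max [Finite E] {v P : Γ.Point} {K : Set Γ.Point} (h : Arc v P K)
    {f : Γ.Point → ℝ} (hf : Γ.IsRational f) {M : ℝ} (hM : ∀ x, f x ≤ M) (hP : f P = M)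
    (hord : ∀ x ∈ K, x ≠ P → 0 ≤ Γ.ord f x)
    (hdir : ∀ d, Γ.base d = P → (∃ δ > 0, ∀ u ∈ Ioc 0 δ, Γ.ray d u ∈ K) → 0 ≤ Γ.slope f d) :
    ∀ x ∈ K, f x = M := by
  induction h with
  | nil => rintro x rfl; exact hP
  | @cons d s hs K hK hdisj ih =>
    have hbK : Γ.base d ∉ K := hdisj 0 ⟨le_rfl, hs.1⟩
    have hseg : ∀ u ∈ Icc 0 s, f (Γ.ray d u) = M := fun u hu => by
      refine hf.eq_max_on_ray hM hP (hdir d rfl ⟨s, hs.1, fun u hu =>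
        Or.inl ⟨u, ⟨hu.1.le, hu.2⟩, rfl⟩⟩) hs.2 (fun w hw => ?_) hu
      refine hord _ (Or.inl ⟨w, ⟨hw.1.le, hw.2.le⟩, rfl⟩) fun heq => ?_
      have := ray_injOn d (s := w) (t := 0) ⟨hw.1, hw.2.trans_le hs.2⟩
        ⟨le_rfl, d.length_pos.le⟩ heq.symm
      exact hw.1.ne this
    have hs1 := hseg s ⟨hs.1.le, le_rfl⟩
    have hne : ∀ x ∈ K, x ≠ Γ.base d := fun x hx heq => hbK (heq ▸ hx)
    rintro x (⟨u, hu, rfl⟩ | hx)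
    · exact hseg u hu
    · exact ih hs1 (fun x hx _ => hord x (Or.inr hx) (hne x hx)) (fun d' hd' _ =>
        (hf.slope_eq_zero (by rwa [hs1]) (hord _ (Or.inr hK.left_mem) (hne _ hK.left_mem)) hd').ge)
        x hx

/-! ### Concentration at the base point -/

namespace IsReducedFamily

variable [Finite V] [Finite E] {F : Γ.Point → Γ.Divisor} {a : ℤ}

/-- No chip of the divisor reduced at the start of an arc lies elsewhere on the arc. The base point is
moved along the arc backwards from its end. As long as the rest of the arc is free of chips it belongs
to the locus where the transfer function of `exists_slide` is extremal, so that no chip can enter it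
when the base point moves on, nor be there in the limit. -/
theorem eq_zero_on_arc (hF : IsReducedFamily F a) (ha : 1 ≤ a) {v P : Γ.Point} {K : Set Γ.Point}
    (h : Arc v P K) : ∀ x ∈ K, x ≠ P → F P x = 0 := by
  induction h with
  | nil => exact fun x hx hne => absurd hx hne
  | @cons d s hs K hK hdisj ih =>
    let p : ℝ → Prop := fun w => ∀ x ∈ Γ.ray d '' Icc (s - w) s ∪ K, x ≠ Γ.ray d (s - w) →
      F (Γ.ray d (s - w)) x = 0
    suffices hp : ∀ w ∈ Icc 0 s, p w by
      have := hp s ⟨hs.1.le, le_rfl⟩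
      simpa only [p, sub_self, ray_zero] using this
    refine Icc_induction ?_ (fun w hw hp => ?_) fun w hw hp => ?_
    · simp only [p, sub_zero, Icc_self, image_singleton, singleton_union,
        insert_eq_of_mem hK.left_mem]
      exact ih
    · -- The base point moves on from `P` to a nearby `Q`, and `f` is maximal along the old rest.
      have hpw := hp w ⟨hw.1, le_rfl⟩
      set u := s - w with hu
      have hu0 : 0 < u := sub_pos.2 hw.2
      have hus : u ≤ s := by linarith [hw.1]
      have hul : u ∈ Ioc 0 d.length := ⟨hu0, hus.trans hs.2⟩
      set d₁ := d.rev u hul with hd₁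
      have hb : Γ.base d₁ = Γ.ray d u := base_rev d hul
      obtain ⟨ε, hε, -, -, hslide⟩ := hF.exists_slide ha d₁
      refine ⟨w + min ε u, by linarith [lt_min hε hu0], fun z hz => ?_⟩
      have hy0 : 0 < z - w := sub_pos.2 hz.1
      have hyε : z - w < ε := by linarith [hz.2, min_le_left ε u]
      have hyu : z - w < u := by linarith [hz.2, min_le_right ε u]
      have hQ : Γ.ray d₁ (z - w) = Γ.ray d (s - z) := by rw [ray_rev]; congr 1; rw [hu]; ring
      obtain ⟨f, hf, htr, hmax, hmin⟩ := hF.exists_transfer ha (Γ.ray d u) (Γ.ray d (s - z))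
      obtain ⟨hflat, -, hP0, hbetween, -⟩ := hslide (z - w) ⟨hy0, hyε⟩ f hf
        (by rw [hQ, hb]; exact htr) (by rw [hb]; exact hmax) (by rw [hQ]; exact hmin)
      rw [hQ, hb] at hP0
      rw [hQ] at hbetween
      have harc := Arc.tail hs hK hdisj ⟨hu0.le, hus⟩
      have hfmax := harc.eq_max hf hmax rfl (fun x hx hne => by
        have h1 := htr x
        rw [hpw x hx hne, Int.cast_zero, zero_add] at h1
        rw [← h1]
        exact_mod_cast hF.nonneg ha _ x) fun d' hd' ⟨δ, hδ, hin⟩ => by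
          refine (hflat d' (hd'.trans hb.symm) ?_).ge
          rintro rfl
          have hm : 0 < min δ (u / 2) := lt_min hδ (half_pos hu0)
          have hm2 := min_le_right δ (u / 2)
          refine Arc.ray_notMem_tail hs hdisj (w := u - min δ (u / 2)) (u := u)
            (by linarith) (by linarith) hus ?_
          rw [← ray_rev d hul]
          exact hin _ ⟨hm, min_le_left _ _⟩
      have hrest : ∀ x ∈ Γ.ray d '' Icc u s ∪ K, F (Γ.ray d (s - z)) x = 0 := fun x hx => by
        by_cases hne : x = Γ.ray d u
        · rw [hne, hP0]
        · have h1 := htr x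
          have h2 := hf.ord_nonpos (P := x) (by rwa [hfmax x hx])
          rw [hpw x hx hne, Int.cast_zero, zero_add] at h1
          have h3 : (F (Γ.ray d (s - z)) x : ℝ) ≤ 0 := h1.trans_le h2
          exact le_antisymm (by exact_mod_cast h3) (hF.nonneg ha _ x)
      rintro x (⟨y, hy, rfl⟩ | hx) hne
      · rcases le_or_gt u y with huy | hyu'
        · exact hrest _ (Or.inl ⟨y, ⟨huy, hy.2⟩, rfl⟩)
        · have hsz : s - z < y := hy.1.lt_of_ne fun h => hne (h ▸ rfl)
          have := hbetween (u - y) ⟨by linarith, by linarith⟩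
          rwa [ray_rev, sub_sub_cancel] at this
      · exact hrest x (Or.inr hx)
    · -- The base point `Q` approaches `P`, and `f` is minimal along the rest of the arc from `Q`.
      set u := s - w with hu
      have hu0 : 0 ≤ u := sub_nonneg.2 hw.2
      have hus : u < s := by linarith [hw.1]
      have hul : u ∈ Ico 0 d.length := ⟨hu0, hus.trans_le hs.2⟩
      set d₁ := d.adv u hul with hd₁
      have hb : Γ.base d₁ = Γ.ray d u := base_adv d hul
      obtain ⟨ε, hε, hεl, hfree, hslide⟩ := hF.exists_slide ha d₁
      obtain ⟨y, hy0, hy⟩ := exists_between (lt_min hε hw.1)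
      have hyε := hy.trans_le (min_le_left _ _)
      have hyw := hy.trans_le (min_le_right _ _)
      have hpy := hp (w - y) ⟨by linarith, by linarith⟩
      have huy : s - (w - y) = u + y := by rw [hu]; ring
      simp only [p, huy] at hpy
      have hQ : Γ.ray d₁ y = Γ.ray d (u + y) := ray_adv d hul y
      have hyl : y ∈ Ioo 0 d₁.length := ⟨hy0, hyε.trans_le hεl⟩
      have huys : u + y ≤ s := by linarith
      obtain ⟨f, hf, htr, hmax, hmin⟩ := hF.exists_transfer ha (Γ.ray d u) (Γ.ray d (u + y))
      obtain ⟨-, -, -, -, hflat⟩ := hslide y ⟨hy0, hyε⟩ f hf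
        (by rw [hQ, hb]; exact htr) (by rw [hb]; exact hmax) (by rw [hQ]; exact hmin)
      have harc := Arc.tail hs hK hdisj ⟨by linarith, huys⟩
      have hfmin := harc.eq_max hf.neg (fun x => neg_le_neg (hmin x)) rfl (fun x hx hne => by
        have h1 := htr x
        rw [hpy x hx hne, Int.cast_zero] at h1
        rw [hf.ord_neg]
        have h2 : (0 : ℝ) ≤ F (Γ.ray d u) x := by exact_mod_cast hF.nonneg ha _ x
        linarith) fun d' hd' ⟨δ, hδ, hin⟩ => by
          rw [(hf.hasGerm d').neg.slope_eq]
          rcases eq_adv_or_rev d₁ hyl (hd'.trans hQ.symm) with rfl | rfl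
          · rw [hflat, neg_zero]
          · exfalso
            have hm : 0 < min δ (y / 2) := lt_min hδ (half_pos hy0)
            have hm2 := min_le_right δ (y / 2)
            refine Arc.ray_notMem_tail hs hdisj (w := u + y - min δ (y / 2)) (u := u + y)
              (by linarith) (by linarith) huys ?_
            rw [add_sub_assoc, ← ray_adv d hul, ← hd₁, ← ray_rev d₁ (Ioo_subset_Ioc_self hyl)]
            exact hin _ ⟨hm, min_le_left _ _⟩
      have hrest : ∀ x ∈ Γ.ray d '' Icc (u + y) s ∪ K, x ≠ Γ.ray d (u + y) →
          F (Γ.ray d u) x = 0 := fun x hx hne => by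
        have h1 := htr x
        have h2 := hf.ord_nonneg (P := x) fun z => by
          rw [neg_injective (hfmin x hx)]; exact hmin z
        rw [hpy x hx hne, Int.cast_zero] at h1
        have h3 : (F (Γ.ray d u) x : ℝ) ≤ 0 := by linarith
        exact le_antisymm (by exact_mod_cast h3) (hF.nonneg ha _ x)
      have hseg : ∀ z, u < z → z ≤ u + y → F (Γ.ray d u) (Γ.ray d z) = 0 := fun z hz hz' => by
        have := hfree (z - u) ⟨by linarith, by linarith⟩
        rwa [hb, ray_adv, add_sub_cancel] at this
      rintro x (⟨z, hz, rfl⟩ | hx) hne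
      · have huz : u < z := hz.1.lt_of_ne fun h => hne (h ▸ rfl)
        rcases le_or_gt z (u + y) with hzy | hzy
        · exact hseg z huz hzy
        · by_cases heq : Γ.ray d z = Γ.ray d (u + y)
          · rw [heq]; exact hseg _ (by linarith) le_rfl
          · exact hrest _ (Or.inl ⟨z, ⟨hzy.le, hz.2⟩, rfl⟩) heq
      · by_cases heq : x = Γ.ray d (u + y)
        · rw [heq]; exact hseg _ (by linarith) le_rfl
        · exact hrest x (Or.inr hx) heq

theorem eq_single (hF : IsReducedFamily F a) (ha : 1 ≤ a) (P : Γ.Point) :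
    F P = Finsupp.single P a := by
  classical
  ext x
  rw [Finsupp.single_apply]
  split_ifs with h
  · rw [← h, hF.apply_self]
  · obtain ⟨K, hK⟩ := exists_arc x P
    exact hF.eq_zero_on_arc ha hK x hK.right_mem (Ne.symm h)

/-- If all vertices are connected without using the edge `e₀`, there is no family of reduced divisors
of constant coefficient: sliding the base point along `e₀` from `P` to `Q`, the transfer function is
maximal at `P`, and the maximum propagates to `Q` along the complement of the segment `PQ`. -/
theorem false_of_connected_compl (hF : IsReducedFamily F a) (ha : 1 ≤ a) (e₀ : E)
    (hconn : ∀ u v, Relation.EqvGen (fun x y => ∃ e, e ≠ e₀ ∧ Γ.src e = x ∧ Γ.tgt e = y) u v) :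
    False := by
  have hL := Γ.len_pos e₀
  set L := Γ.len e₀ with hLdef
  let d : Γ.Dir := .fwd e₀ (L / 2) ⟨by linarith, by linarith⟩
  let d' : Γ.Dir := .bwd e₀ (L / 2) ⟨by linarith, by linarith⟩
  let dT : Γ.Dir := .bwd e₀ L ⟨hL, le_rfl⟩
  have hb : Γ.base d = Γ.edgePt e₀ (L / 2) := by simp [base, ray, d]
  have hb' : Γ.base d' = Γ.base d := by rw [hb]; simp [base, ray, d']
  have hPmem : L / 2 ∈ Ioo 0 (Γ.len e₀) := ⟨by linarith, by linarith⟩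
  obtain ⟨ε, hε, hεl, -, hslide⟩ := hF.exists_slide ha d
  have hlen : d.length = L / 2 := by
    change L - L / 2 = L / 2
    ring
  rw [hlen] at hεl
  obtain ⟨s, hs0, hsε⟩ := exists_between hε
  obtain ⟨f, hf, htr, hmax, hmin⟩ := hF.exists_transfer ha (Γ.base d) (Γ.ray d s)
  obtain ⟨hflat, hslope, -, -, -⟩ := hslide s ⟨hs0, hsε⟩ f hf htr hmax hmin
  have hord : ∀ x, x ≠ Γ.base d → 0 ≤ Γ.ord f x := fun x hx => by
    have h1 := htr x
    have h2 : F (Γ.base d) x = 0 := by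
      rw [hF.eq_single ha (Γ.base d), Finsupp.single_eq_of_ne hx]
    rw [h2, Int.cast_zero, zero_add] at h1
    rw [← h1]
    exact_mod_cast hF.nonneg ha _ x
  have hne : ∀ e t, (e ≠ e₀ ∨ t ≠ L / 2) → Γ.edgePt e t ≠ Γ.base d := fun e t h heq => by
    rw [hb] at heq
    obtain ⟨h1, h2⟩ := eq_of_edgePt_eq hPmem heq
    exact h.elim (fun h => h h1) fun h => h h2
  set M := f (Γ.base d) with hM
  have hsrc : f (.vertex (Γ.src e₀)) = M := by
    have h1 := hf.eq_max_on_ray hmax (d := d') (by rw [hb']) (hflat d' hb' (by simp [d, d'])).ge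
      (s := L / 2) le_rfl (fun u hu => hord _ (hne e₀ _ (Or.inr (by linarith [hu.1]))))
      (u := L / 2) ⟨by linarith, le_rfl⟩
    rwa [show Γ.ray d' (L / 2) = .vertex (Γ.src e₀) from by simp [ray, d', edgePt_zero]] at h1
  have hvert : ∀ (d₂ : Γ.Dir) (v w : V), Γ.base d₂ = .vertex v → Γ.ray d₂ d₂.length = .vertex w →
      (∀ u, Γ.ray d₂ u ≠ Γ.base d) → f (.vertex v) = M → f (.vertex w) = M := by
    intro d₂ v w hv hw hd₂ hvM
    have hv' : 0 ≤ Γ.ord f (.vertex v) := hord _ (by rw [← hv]; exact hd₂ 0)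
    rw [← hw]
    exact hf.eq_max_on_ray hmax (by rw [hv, hvM])
      (hf.slope_eq_zero (by rwa [hvM]) hv' hv).ge le_rfl (fun u _ => hord _ (hd₂ u))
      ⟨d₂.length_pos.le, le_rfl⟩
  have hall : ∀ u v, f (.vertex u) = M ↔ f (.vertex v) = M := fun u v => by
    have := hconn u v
    induction this with
    | rel x y hxy =>
      obtain ⟨e, he, rfl, rfl⟩ := hxy
      constructor
      · refine hvert (.fwd e 0 ⟨le_rfl, Γ.len_pos e⟩) _ _ ?_ ?_ fun u => hne _ _ (Or.inl he)
        · simp [base, ray, edgePt_zero]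
        · simp [ray, Dir.length, edgePt_len]
      · refine hvert (.bwd e (Γ.len e) ⟨Γ.len_pos e, le_rfl⟩) _ _ ?_ ?_ fun u => hne _ _ (Or.inl he)
        · simp [base, ray, edgePt_len]
        · simp [ray, Dir.length, edgePt_zero]
    | refl x => rfl
    | symm x y _ ih => exact ih.symm
    | trans x y z _ _ ih ih' => exact ih.trans ih'
  have htgt : f (.vertex (Γ.tgt e₀)) = M := (hall _ _).1 hsrc
  have hbT : Γ.base dT = .vertex (Γ.tgt e₀) := by simp [base, ray, dT, hLdef, edgePt_len]
  have hordT : 0 ≤ Γ.ord f (.vertex (Γ.tgt e₀)) :=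
    hord _ (by rw [hb]; exact (edgePt_ne_vertex hPmem _).symm)
  have hQ : f (Γ.ray d s) = M := by
    have h1 := hf.eq_max_on_ray hmax (d := dT) (by rw [hbT, htgt])
      (hf.slope_eq_zero (by rwa [htgt]) hordT hbT).ge (s := L / 2 - s)
      (by change L / 2 - s ≤ L; linarith)
      (fun u hu => hord _ (hne e₀ _ (Or.inr (by linarith [hu.2]))))
      (u := L / 2 - s) ⟨by linarith, le_rfl⟩
    rwa [show Γ.ray dT (L / 2 - s) = Γ.ray d s from by simp only [ray, dT, d]; congr 1; ring] at h1
  have h1 := hf.slope_nonneg d fun x => by rw [← hM, ← hQ]; exact hmin x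
  rw [hslope] at h1
  have : (1 : ℝ) ≤ a := by exact_mod_cast ha
  linarith

end IsReducedFamily

/-- A curve of positive genus has an edge whose removal does not disconnect it, namely any edge that
does not contribute to a spanning tree. -/
theorem exists_edge_connected_compl [Finite V] [Finite E] (hg : 1 ≤ Γ.genus) : ∃ e₀ : E, ∀ u v,
    Relation.EqvGen (fun x y => ∃ e, e ≠ e₀ ∧ Γ.src e = x ∧ Γ.tgt e = y) u v := by
  classical
  have := Fintype.ofFinite V
  have := Fintype.ofFinite E
  have := Γ.nonempty
  let G : SimpleGraph V := SimpleGraph.fromRel fun x y => ∃ e, Γ.src e = x ∧ Γ.tgt e = y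
  have hG : G.Connected := by
    refine SimpleGraph.connected_iff _ |>.2 ⟨fun u v => ?_, inferInstance⟩
    have := Γ.connected u v
    induction this with
    | rel x y hxy =>
      by_cases h : x = y
      · rw [h]
      · exact SimpleGraph.Adj.reachable ((SimpleGraph.fromRel_adj _ _ _).2 ⟨h, Or.inl hxy⟩)
    | refl x => rfl
    | symm x y _ ih => exact ih.symm
    | trans x y z _ _ ih ih' => exact ih.trans ih'
  obtain ⟨T, hTG, hT⟩ := hG.exists_isTree_le
  have hc : ∀ z : T.edgeSet, ∃ e, s(Γ.src e, Γ.tgt e) = (z : Sym2 V) := by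
    rintro ⟨z, hz⟩
    induction z with
    | h x y =>
      obtain ⟨-, ⟨e, rfl, rfl⟩ | ⟨e, rfl, rfl⟩⟩ := (SimpleGraph.fromRel_adj _ _ _).1 (hTG hz)
      · exact ⟨e, rfl⟩
      · exact ⟨e, Sym2.eq_swap⟩
  choose c hc using hc
  obtain ⟨e₀, he₀⟩ : ∃ e₀, ∀ z, c z ≠ e₀ := by
    by_contra! hsurj
    have h1 := Fintype.card_le_of_surjective c hsurj
    have h2 := hT.card_edgeFinset
    rw [SimpleGraph.edgeFinset, Set.toFinset_card] at h2
    rw [genus, Nat.card_eq_fintype_card, Nat.card_eq_fintype_card] at hg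
    omega
  refine ⟨e₀, fun u v => ?_⟩
  obtain ⟨p⟩ := hT.connected.preconnected u v
  induction p with
  | nil => exact .refl _
  | @cons x y z h _ ih =>
    refine .trans _ _ _ ?_ ih
    have h1 := hc ⟨s(x, y), h⟩
    rcases Sym2.eq_iff.1 h1 with ⟨h2, h3⟩ | ⟨h2, h3⟩
    · exact .rel _ _ ⟨_, he₀ _, h2, h3⟩
    · exact .symm _ _ (.rel _ _ ⟨_, he₀ _, h2, h3⟩)

/-! ### Weierstrass points -/

section Weierstrass

variable {D : Γ.Divisor}

/-- A positive coefficient shows that `reducedDivisor` is not the junk value `0` assigned when there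
is no reduced divisor. -/
theorem reducedDivisor_spec {P : Γ.Point} (h : 0 < Γ.reducedDivisor D P P) :
    Γ.IsReduced P (Γ.reducedDivisor D P) ∧ Γ.LinEquiv (Γ.reducedDivisor D P) D := by
  unfold reducedDivisor at h ⊢
  split_ifs at h ⊢ with hex
  · exact hex.choose_spec
  · simp at h

variable [Finite V] [Finite E]

theorem exists_lt_reducedDivisor {a : ℤ} (ha : 1 ≤ a) (hor : 1 ≤ Γ.genus ∨ a < Γ.deg D)
    (h : ∀ P : Γ.Point, a ≤ Γ.reducedDivisor D P P) :
    ∃ P : Γ.Point, a + 1 ≤ Γ.reducedDivisor D P P := by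
  by_contra! hlt
  have hspec := fun P => reducedDivisor_spec (D := D) (P := P) (lt_of_lt_of_le (by omega) (h P))
  have hF : IsReducedFamily (Γ.reducedDivisor D) a :=
    ⟨fun P => (hspec P).1, fun P Q => (hspec P).2.trans (hspec Q).2.symm, fun P => by
      have := h P
      have := hlt P
      omega⟩
  rcases hor with hg | hdeg
  · obtain ⟨e₀, he₀⟩ := exists_edge_connected_compl hg
    exact hF.false_of_connected_compl ha e₀ he₀
  · obtain ⟨v⟩ := Γ.nonempty
    have h1 := (hspec (.vertex v)).2.deg_eq
    rw [hF.eq_single ha, deg_single] at h1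
    omega

/-- The coefficient of the reduced divisor is at least the rank. -/
theorem rank_le_reducedDivisor (hD : 0 < Γ.rank D) (P : Γ.Point) :
    Γ.rank D ≤ Γ.reducedDivisor D P P := by
  set S := {n : ℕ | ∃ D' : Γ.Divisor, 0 ≤ D' ∧ Γ.deg D' = n ∧ Γ.linearSystem (D - D') = ∅} with hS
  have hr : Γ.rank D = (sInf S : ℕ) - 1 := rfl
  have hnS : sInf S - 1 ∉ S := fun hmem => by
    have := Nat.sInf_le hmem
    omega
  have hcast : ((sInf S - 1 : ℕ) : ℤ) = Γ.rank D := by omega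
  let R : Γ.Divisor := Finsupp.single P (Γ.rank D)
  have hR : 0 ≤ R := Finsupp.single_nonneg.2 hD.le
  obtain ⟨D₁, hD₁, f, hf, hD₁f⟩ : (Γ.linearSystem (D - R)).Nonempty := by
    by_contra hne
    exact hnS ⟨R, hR, by rw [deg_single, hcast], Set.not_nonempty_iff_eq_empty.1 hne⟩
  have hlin : Γ.LinEquiv (D₁ + R) D := ⟨f, hf, fun Q => by
    have := hD₁f Q
    rw [Finsupp.sub_apply, Int.cast_sub] at this
    rw [Finsupp.add_apply, Int.cast_add, this]
    ring⟩
  have hex : ∃ D' : Γ.Divisor, Γ.IsReduced P D' ∧ Γ.LinEquiv D' D := by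
    obtain ⟨D', hred, h⟩ := exists_isReduced (add_nonneg hD₁ hR) P
    exact ⟨D', hred, h.trans hlin⟩
  have hspec : Γ.IsReduced P (Γ.reducedDivisor D P) ∧ Γ.LinEquiv (Γ.reducedDivisor D P) D := by
    rw [reducedDivisor, dif_pos hex]
    exact hex.choose_spec
  obtain ⟨g, hg, hgeq⟩ := hlin.trans hspec.2.symm
  have hmax := hspec.1.le_apply hg fun v _ => by
    rw [← hgeq]
    exact_mod_cast add_nonneg hD₁ hR v
  have h1 := hgeq P
  have h2 := hg.ord_nonpos hmax
  have h3 : ((D₁ + R) P : ℝ) ≤ Γ.reducedDivisor D P P := by linarith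
  have h4 : (D₁ + R) P ≤ Γ.reducedDivisor D P P := by exact_mod_cast h3
  have h5 : R P = Γ.rank D := Finsupp.single_eq_same
  rw [Finsupp.add_apply, h5] at h4
  have h6 : 0 ≤ D₁ P := hD₁ P
  omega

end Weierstrass

end MetricGraph

theorem theorem14 {V E : Type*} [Finite V] [Finite E] (Γ : MetricGraph V E)
    (D : Γ.Divisor) (hD : 0 < Γ.rank D) :
    (∀ a : ℤ, 1 ≤ a → (1 ≤ Γ.genus ∨ a < Γ.deg D) →
      (∀ P : Γ.Point, a ≤ Γ.reducedDivisor D P P) →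
      ∃ P : Γ.Point, a + 1 ≤ Γ.reducedDivisor D P P) ∧
    (1 ≤ Γ.genus → ∃ P : Γ.Point, Γ.IsWeierstrassPoint D P) :=
  ⟨fun _ ha hor h => MetricGraph.exists_lt_reducedDivisor ha hor h, fun hg =>
    MetricGraph.exists_lt_reducedDivisor hD (Or.inl hg) (MetricGraph.rank_le_reducedDivisor hD)⟩
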